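/- Let $\Omega$ be the set of all finite (possibly empty) sequences of natural numbers, ordered by $s\sqsubseteq t$ iff $s$ is an initial segment of $t$. For a downwards-closed $\mathcal T\subseteq\Omega$ let $\partial\mathcal T$ be the set of infinite branches (infinite maximal chains) of $\mathcal T$ and $\overline{\mathcal T}=\mathcal T\cup\partial\mathcal T$, ordered by $\sqsubseteq'$: for $s,t\in\mathcal T$, $s\sqsubseteq' t$ iff $s\sqsubseteq t$; for $s\in\mathcal T$ and $b\in\partial\mathcal T$, $s\sqsubseteq' b$ iff $s\in b$, and never $b\sqsubseteq' s$; for $b,c\in\partial\mathcal T$, $b\sqsubseteq' c$ iff $b=c$. The coarse wedge topology of $\overline{\mathcal T}$ is the topology having as a subbase all sets $\{s : t\sqsubseteq' s\}$ and their complements, where $t\in\overline{\mathcal T}$ is such that the (well-ordered) set of strict predecessors of $t$ has order type $0$ or a successor ordinal. A set $A$ in a Banach space is $\epsilon$-separated if $\|x-y\|>\epsilon$ for all distinct $x,y\in A$. **Theorem.** Let $W$ and $Z$ be Banach spaces over the same field, $\mathbb R$ or $\mathbb C$, with $Z$ separable. Let $R:W\to Z$ be a bounded linear operator, $K\subseteq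 Z^*$ and $\epsilon>0$ be such that $K$ is absolutely convex and weak$^*$-compact and $R^*(K)$ contains an uncountable $\epsilon$-separated subset. Then for any $\delta>0$, any $\theta>0$, any downwards-closed $\mathcal T\subseteq\Omega$, and any bijection $\tau:\mathbb N=\{0,1,2,\dots\}\to\mathcal T$ such that $\tau(l)\sqsubseteq\tau(m)$ implies $l\le m$, there exist families $(w_t)_{t\in\mathcal T}$ of norm-one vectors of $W$ and $(z_t^*)_{t\in\overline{\mathcal T}}\subseteq K$ such that: (i) for all $s\in\mathcal T$ and $t\in\overline{\mathcal T}$: if $s\sqsubseteq' t$, then $\langle z_t^*,Rw_s\rangle=\langle z_s^*,Rw_s\rangle$, and this number is real and $>\frac{\epsilon}{2+\theta}$; if $s\not\sqsubseteq' t$, then $\langle z_t^*,Rw_s\rangle=0$; (ii) the map $t\mapsto z_t^*$ from $\overline{\mathcal T}$ with the coarse wedge topology to $Z^*$ with the weak$^*$ topology is continuous; (iii) $(w_{\tau(m)})_{m=0}^\infty$ is a basic sequence (a Schauder basis of its closed linear span) with basis constant not exceeding $1+\delta$; and (iv) with $Z_0:=\bigcap_{t\in\mathcal T}\ker(z_t^*)$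 and $Q:Z\to Z/Z_0$ the quotient map, $(QRw_{\tau(m)})_{m=0}^\infty$ is a Schauder basis of $Z/Z_0$ with basis constant not exceeding $1+\delta$. Here the basis constant of a Schauder basis is the supremum of the norms of its partial-sum projections. -/

import Mathlib

open scoped ComplexOrder

/-- The coarse wedge topology of a tree: the subbase consists of the wedges `{s | t ≤ s}` and their
complements, over those `t` whose set of strict predecessors has order type `0` (it is empty) or a
successor (it has a greatest element). -/
@[reducible] def coarseWedgeTopology (α : Type*) [PartialOrder α] : TopologicalSpace α :=
  TopologicalSpace.generateFrom
    {U | ∃ t : α, (Set.Iio t = ∅ ∨ ∃ m, IsGreatest (Set.Iio t) m) ∧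
      (U = Set.Ici t ∨ U = (Set.Ici t)ᶜ)}

/-- A set of finite sequences of natural numbers that is closed under initial segments. -/
def IsDownClosed (T : Set (List ℕ)) : Prop :=
  ∀ t ∈ T, ∀ s : List ℕ, s <+: t → s ∈ T

/-- An infinite branch of `T`: an infinite maximal totally ordered subset of `T`, for the order
"is an initial segment of". -/
def IsInfiniteBranch (T b : Set (List ℕ)) : Prop :=
  b.Infinite ∧ Maximal (fun c : Set (List ℕ) => c ⊆ T ∧ IsChain (· <+: ·) c) b

/-- The chain completion of `T`: its nodes together with its infinite branches. -/
inductive TreeBar (T : Set (List ℕ)) : Type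
  | node (t : T) : TreeBar T
  | branch (b : {b : Set (List ℕ) // IsInfiniteBranch T b}) : TreeBar T

namespace TreeBar

/-- The extension to `TreeBar T` of the order "is an initial segment of". -/
def le {T : Set (List ℕ)} : TreeBar T → TreeBar T → Prop
  | node s, node t => (s : List ℕ) <+: (t : List ℕ)
  | node s, branch b => (s : List ℕ) ∈ (b : Set (List ℕ))
  | branch _, node _ => False
  | branch b, branch c => b = c

theorem mem_branch_of_prefix {T b : Set (List ℕ)} (hb : IsInfiniteBranch T b) {s t : List ℕ}
    (hs : s ∈ T) (hst : s <+: t) (ht : t ∈ b) : s ∈ b := by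
  have hc : IsChain (· <+: ·) (insert s b) := by
    refine hb.2.prop.2.insert ?_
    intro c hcb _
    rcases hb.2.prop.2.total ht hcb with h | h
    · exact Or.inl (hst.trans h)
    · exact List.prefix_or_prefix_of_prefix hst h
  exact hb.2.le_of_ge ⟨Set.insert_subset hs hb.2.prop.1, hc⟩ (Set.subset_insert s b)
    (Set.mem_insert s b)

instance instPartialOrder (T : Set (List ℕ)) : PartialOrder (TreeBar T) where
  le := le
  le_refl x := by
    cases x with
    | node s => exact List.prefix_rfl
    | branch b => exact rfl
  le_trans x y z hxy hyz := by
    cases x <;> cases y <;> cases z <;> simp only [le] at *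
    · exact hxy.trans hyz
    · rename_i s t b
      exact mem_branch_of_prefix b.2 s.2 hxy hyz
    · rename_i s b c
      exact hyz ▸ hxy
    · exact hxy.trans hyz
  le_antisymm x y hxy hyx := by
    cases x <;> cases y <;> simp only [le] at *
    · rename_i s t
      have h : s = t := Subtype.ext (hxy.eq_of_length (le_antisymm hxy.length_le hyx.length_le))
      rw [h]
    · rw [hxy]

instance instTopologicalSpace (T : Set (List ℕ)) : TopologicalSpace (TreeBar T) :=
  coarseWedgeTopology (TreeBar T)

end TreeBar

/-- The sequence `x` is a (Schauder) basis of `X` with basis constant at most `C`. -/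
def IsBasisWithConstLE (𝕜 : Type*) [RCLike 𝕜] {X : Type*} [NormedAddCommGroup X] [NormedSpace 𝕜 X]
    (x : ℕ → X) (C : ℝ) : Prop :=
  ∃ b : SchauderBasis 𝕜 X, (∀ m, b m = x m) ∧ b.enormProjBound ≤ ENNReal.ofReal C

/-- The sequence `x` is a basic sequence, that is, a basis of its closed linear span, with basis
constant at most `C`. -/
def IsBasicWithConstLE (𝕜 : Type*) [RCLike 𝕜] {X : Type*} [NormedAddCommGroup X] [NormedSpace 𝕜 X]
    (x : ℕ → X) (C : ℝ) : Prop :=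
  IsBasisWithConstLE 𝕜 (X := (Submodule.span 𝕜 (Set.range x)).topologicalClosure)
    (fun m => ⟨x m, Submodule.le_topologicalClosure _ (Submodule.subset_span ⟨m, rfl⟩)⟩) C

/-- The common kernel of a family of functionals. -/
def commonKer {𝕜 : Type*} [RCLike 𝕜] {Z : Type*} [NormedAddCommGroup Z] [NormedSpace 𝕜 Z]
    {ι : Type*} (f : ι → StrongDual 𝕜 Z) : Submodule 𝕜 Z :=
  ⨅ i, (f i).toLinearMap.ker

/-- The quotient by the common kernel is a normed space because the common kernel is closed. -/
instance commonKer_isClosed {𝕜 : Type*} [RCLike 𝕜] {Z : Type*} [NormedAddCommGroup Z]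
    [NormedSpace 𝕜 Z] {ι : Type*} (f : ι → StrongDual 𝕜 Z) :
    IsClosed (commonKer f : Set Z) := by
  rw [commonKer, Submodule.coe_iInf]
  exact isClosed_iInter fun i => (f i).isClosed_ker

/-!
Slightly shrink `K` to `a • K` and pick a subset `B` of it with no weak*-isolated points whose
image under `R^*` is still separated. Along the enumeration of the tree, attach to the node `n`
with parent `p` a point `x n ∈ B` weak*-close to `x p`, and correct the increment `x n - x p` by a
small multiple of an element of `K` to a functional `y n` that annihilates the earlier vectors
`R (w i)`. Infinitely many candidates for `x n` are available. If all of them were small on the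
common kernel of given finitely many functionals on `W`, Hahn–Banach would put them near a
finite-dimensional space and contradict separation; so one of them is large at `R w` for some unit
vector `w` in that kernel, and this `w` is `w n`. Annihilation and smallness at finite norming sets
make both sequences basic by Mazur's method. Along a path of the tree the increments telescope, so
the errors being summable the partial sums stay in `K`, and `z t` is the weak* sum of the `y n`
over the nodes `n` below `t`. On a dense set this series converges uniformly in `t`, which gives
continuity.
-/

open scoped Pointwise
open Filter Topology

section Basis

variable {𝕜 : Type*} [RCLike 𝕜] {X : Type*} [NormedAddCommGroup X] [NormedSpace 𝕜 X]

theorem IsBasisWithConstLE.mono {x : ℕ → X} {C C' : ℝ} (h : IsBasisWithConstLE 𝕜 x C)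
    (hC : C ≤ C') : IsBasisWithConstLE 𝕜 x C' :=
  let ⟨b, hb, hbC⟩ := h
  ⟨b, hb, hbC.trans (ENNReal.ofReal_le_ofReal hC)⟩

theorem equicontinuous_of_norm_le {ι Y : Type*} [NormedAddCommGroup Y] [NormedSpace 𝕜 Y]
    {P : ι → X →L[𝕜] Y} {C : ℝ} (hP : ∀ i, ‖P i‖ ≤ C) : Equicontinuous fun i => ⇑(P i) :=
  ((NormedSpace.equicontinuous_TFAE P).out 5 1 : (∃ C, ∀ i, ‖P i‖ ≤ C) ↔ _).1 ⟨C, hP⟩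

section Biorthogonal

variable {x : ℕ → X} {f : ℕ → StrongDual 𝕜 X} (hf : ∀ i j, f i (x j) = if i = j then 1 else 0)
include hf

theorem eventually_sum_coord_eq_of_mem_span {v : X} (hv : v ∈ Submodule.span 𝕜 (Set.range x)) :
    ∀ᶠ n in atTop, ∑ i ∈ Finset.range n, f i v • x i = v := by
  induction hv using Submodule.span_induction with
  | mem v hv =>
    obtain ⟨j, rfl⟩ := hv
    filter_upwards [eventually_gt_atTop j] with n hn
    simp [hf, hn]
  | zero => simp
  | add u v _ _ hu hv =>
    filter_upwards [hu, hv] with n hun hvn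
    simp [add_smul, Finset.sum_add_distrib, hun, hvn]
  | smul c v _ hv =>
    filter_upwards [hv] with n hn
    simp only [map_smul, smul_assoc, ← Finset.smul_sum, hn]

theorem tendsto_sum_coord_of_dense_span
    (hx : Dense (Submodule.span 𝕜 (Set.range x) : Set X)) {C : ℝ}
    (hC : ∀ n, ‖∑ i ∈ Finset.range n, (f i).smulRight (x i)‖ ≤ C) (v : X) :
    Tendsto (fun n => ∑ i ∈ Finset.range n, f i v • x i) atTop (𝓝 v) := by
  have hclosed := (equicontinuous_of_norm_le hC).isClosed_setOfPred_tendsto (l := atTop)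
    continuous_id
  have hv := closure_minimal (fun u hu => ?_) hclosed (hx v)
  · simpa using hv
  · refine tendsto_const_nhds.congr' ?_
    filter_upwards [eventually_sum_coord_eq_of_mem_span hf hu] with n hn
    simpa using hn.symm

theorem isBasisWithConstLE_of_biorthogonal
    (hx : Dense (Submodule.span 𝕜 (Set.range x) : Set X)) {C : ℝ}
    (hC : ∀ n v, ‖∑ i ∈ Finset.range n, f i v • x i‖ ≤ C * ‖v‖) :
    IsBasisWithConstLE 𝕜 x C := by
  have hx0 : 0 < ‖x 0‖ := norm_pos_iff.2 fun h => by simpa [h] using hf 0 0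
  have hC0 : 0 ≤ C := nonneg_of_mul_nonneg_left (by simpa using hC 0 (x 0)) hx0
  have hproj : ∀ n, ‖∑ i ∈ Finset.range n, (f i).smulRight (x i)‖ ≤ C := fun n =>
    ContinuousLinearMap.opNorm_le_bound _ hC0 fun v => by simpa using hC n v
  let b : SchauderBasis 𝕜 X :=
    { basis := x
      coord := f
      ortho := fun i j => by simp [hf, Pi.single_apply]
      expansion := fun v => by
        rw [HasSum, SummationFilter.conditional_filter_eq_map_range, tendsto_map'_iff]
        exact tendsto_sum_coord_of_dense_span hf hx hproj v }
  exact ⟨b, fun _ => rfl, iSup_le fun n => by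
    rw [← ofReal_norm]
    exact ENNReal.ofReal_le_ofReal (hproj n)⟩

/-- Mazur's criterion: a functional that norms the `n`-th partial sum of `v` and kills the tail
takes the same value at `v` and at the partial sum. -/
theorem isBasicWithConstLE_of_norming {C : ℝ} (hC : 0 ≤ C)
    (hnorm : ∀ n, ∀ v ∈ Submodule.span 𝕜 (x '' Set.Iio n), ∃ g : StrongDual 𝕜 X,
      ‖g‖ ≤ 1 ∧ ‖v‖ ≤ C * ‖g v‖ ∧ ∀ j, n ≤ j → g (x j) = 0) :
    IsBasicWithConstLE 𝕜 x C := by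
  set E := (Submodule.span 𝕜 (Set.range x)).topologicalClosure
  have hxE : ∀ m, x m ∈ E := fun m =>
    Submodule.le_topologicalClosure _ (Submodule.subset_span ⟨m, rfl⟩)
  refine isBasisWithConstLE_of_biorthogonal (f := fun i => (f i).comp E.subtypeL) hf ?_ ?_
  · refine IsInducing.subtypeVal.dense_iff.2 fun v => ?_
    have hspan : ((↑) : E → X) ''
        (Submodule.span 𝕜 (Set.range fun m => (⟨x m, hxE m⟩ : E)) : Set E) =
          Submodule.span 𝕜 (Set.range x) := by
      rw [← Submodule.coe_subtype, ← Submodule.map_coe, Submodule.map_span, ← Set.range_comp]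
      rfl
    exact hspan ▸ v.2
  · intro n v
    set q := ∑ i ∈ Finset.range n, f i v • x i
    have hq : q ∈ Submodule.span 𝕜 (x '' Set.Iio n) :=
      Submodule.sum_mem _ fun i hi => Submodule.smul_mem _ _
        (Submodule.subset_span ⟨i, Finset.mem_range.1 hi, rfl⟩)
    obtain ⟨g, hg, hgq, hgx⟩ := hnorm n q hq
    have hgP : Set.EqOn (g.comp (∑ i ∈ Finset.range n, (f i).smulRight (x i))) g E := by
      refine ContinuousLinearMap.eqOn_closure_span ?_
      rintro _ ⟨j, rfl⟩
      rcases lt_or_ge j n with hj | hj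
      · simp [hf, hj]
      · simp [hf, hgx j hj, hj.not_gt]
    have hgv : g q = g v := by simpa [q] using hgP v.2
    calc ‖∑ i ∈ Finset.range n, (f i).comp E.subtypeL v • (⟨x i, hxE i⟩ : E)‖ = ‖q‖ := by
          simp [q]
      _ ≤ C * ‖g v‖ := hgv ▸ hgq
      _ ≤ C * ‖v‖ := by gcongr; simpa using g.le_of_opNorm_le hg v

end Biorthogonal

end Basis

section Quotient

variable {𝕜 : Type*} [RCLike 𝕜] {X : Type*} [NormedAddCommGroup X] [NormedSpace 𝕜 X]

theorem IsBasisWithConstLE.mkQ_congr {S S' : Submodule 𝕜 X} [IsClosed (S : Set X)]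
    [IsClosed (S' : Set X)] (hS : S = S') {x : ℕ → X} {C : ℝ}
    (h : IsBasisWithConstLE 𝕜 (fun m => S.mkQ (x m)) C) :
    IsBasisWithConstLE 𝕜 (fun m => S'.mkQ (x m)) C := by
  subst hS
  exact h

variable {X₀ : Submodule 𝕜 X} {x : ℕ → X} {f : ℕ → StrongDual 𝕜 X} {M : ℝ}

theorem summable_coord_smul [CompleteSpace X] (hx : ∀ i, ‖x i‖ ≤ M) {v : X}
    (hv : Summable fun j => ‖f j v‖) : Summable fun j => f j v • x j :=
  .of_norm_bounded (hv.mul_right M) fun j =>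
    (norm_smul_le _ _).trans (mul_le_mul_of_nonneg_left (hx j) (norm_nonneg _))

variable (hX₀ : ∀ v, v ∈ X₀ ↔ ∀ i, f i v = 0)
  (hf : ∀ i j, f i (x j) = if i = j then 1 else 0)
include hX₀ hf

theorem sub_tsum_coord_smul_mem {v : X} (hv : Summable fun j => f j v • x j) :
    v - ∑' j, f j v • x j ∈ X₀ := by
  refine (hX₀ _).2 fun i => ?_
  have : f i (∑' j, f j v • x j) = f i v := by
    rw [(f i).map_tsum hv, tsum_eq_single i fun j hj => by simp [hf, hj.symm]]
    simp [hf]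
  rw [map_sub, this, sub_self]

theorem dense_span_mkQ [IsClosed (X₀ : Set X)] {D : Set X} (hD : Dense D)
    (hDf : ∀ d ∈ D, Summable fun j => f j d • x j) :
    Dense (Submodule.span 𝕜 (Set.range fun m => X₀.mkQ (x m)) : Set (X ⧸ X₀)) := by
  have hmk : DenseRange (X₀.mkQL : X → X ⧸ X₀) := (Submodule.mkQ_surjective X₀).denseRange
  refine ((hmk.dense_image X₀.mkQL.continuous hD).mono ?_).of_closure
  rintro _ ⟨d, hd, rfl⟩
  have hmkd : X₀.mkQL d = X₀.mkQL (∑' j, f j d • x j) :=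
    (Submodule.Quotient.eq X₀).2 (sub_tsum_coord_smul_mem hX₀ hf (hDf d hd))
  rw [hmkd]
  refine mem_closure_of_tendsto ((X₀.mkQL.continuous.tendsto _).comp (hDf d hd).hasSum)
    (Eventually.of_forall fun s => ?_)
  simp only [Function.comp, map_sum, map_smul]
  exact Submodule.sum_mem _ fun i _ => Submodule.smul_mem _ _ (Submodule.subset_span ⟨i, rfl⟩)

variable [CompleteSpace X] (hx : ∀ i, ‖x i‖ ≤ M) {t : ℕ → ℝ} (ht : Summable t)
include hx ht

/-- Since `F` vanishes on `X₀`, `F u` is the sum of all `f j u * F (x j)`, and only the small tail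
is missing on the left. -/
theorem norm_sum_smul_apply_le {F : StrongDual 𝕜 X} (hF : ‖F‖ ≤ 1) (hFX₀ : ∀ v ∈ X₀, F v = 0)
    {n : ℕ} {u : X} (hu : ‖u‖ ≤ 1) (hut : ∀ j, n ≤ j → ‖f j u‖ ≤ t j) :
    ‖(∑ i ∈ Finset.range n, F (x i) • f i) u‖ ≤ 1 + M * ∑' j, t (j + n) := by
  have hM : 0 ≤ M := (norm_nonneg _).trans (hx 0)
  have hsum : Summable fun j => f j u • x j := summable_coord_smul hx <|
    .of_norm_bounded_eventually_nat ht <| (eventually_ge_atTop n).mono fun j hj => by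
      simpa using hut j hj
  have hFu : F u = ∑' j, f j u * F (x j) := by
    rw [← sub_eq_zero, ← hFX₀ _ (sub_tsum_coord_smul_mem hX₀ hf hsum), map_sub, F.map_tsum hsum]
    simp
  have hsplit : F u = (∑ i ∈ Finset.range n, F (x i) • f i) u +
      ∑' j, f (j + n) u * F (x (j + n)) := by
    rw [hFu, ← (show Summable fun j => f j u * F (x j) by
      simpa using F.summable hsum).sum_add_tsum_nat_add n]
    simp [mul_comm]
  have htail : ‖∑' j, f (j + n) u * F (x (j + n))‖ ≤ M * ∑' j, t (j + n) := by
    refine tsum_of_norm_bounded (((summable_nat_add_iff n).2 ht).hasSum.mul_left M) fun j => ?_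
    rw [norm_mul, mul_comm]
    have hFx : ‖F (x (j + n))‖ ≤ M := by simpa using F.le_of_opNorm_le_of_le hF (hx (j + n))
    exact mul_le_mul hFx (hut _ (Nat.le_add_left _ _)) (norm_nonneg _) hM
  have hFu1 : ‖F u‖ ≤ 1 := by simpa using F.le_of_opNorm_le_of_le hF hu
  rw [eq_sub_of_add_eq hsplit.symm]
  exact (norm_sub_le _ _).trans (add_le_add hFu1 htail)

variable (ht0 : ∀ j, 0 ≤ t j) {C : ℝ} (hC : 0 < C)
  (hnorm : ∀ n, ∀ g ∈ Submodule.span 𝕜 (f '' Set.Iio n), ∃ u : X,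
    ‖u‖ ≤ 1 ∧ ‖g‖ ≤ C * ‖g u‖ ∧ ∀ j, n ≤ j → ‖f j u‖ ≤ t j)
include ht0 hC hnorm

theorem norm_sum_smul_mkQ_le [IsClosed (X₀ : Set X)] (n : ℕ) (v : X) :
    ‖∑ i ∈ Finset.range n, f i v • X₀.mkQ (x i)‖ ≤ C * (1 + M * ∑' j, t j) * ‖v‖ := by
  have hM : 0 ≤ M := (norm_nonneg _).trans (hx 0)
  obtain ⟨φ, hφ, hφq⟩ := exists_dual_vector'' 𝕜 (∑ i ∈ Finset.range n, f i v • X₀.mkQ (x i))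
  set F : StrongDual 𝕜 X := φ.comp X₀.mkQL
  have hF : ‖F‖ ≤ 1 := ContinuousLinearMap.opNorm_le_bound _ zero_le_one fun u =>
    φ.le_of_opNorm_le_of_le hφ (Submodule.Quotient.norm_mk_le X₀ u)
  have hFX₀ : ∀ u ∈ X₀, F u = 0 := fun u hu => by
    have : X₀.mkQL u = 0 := (Submodule.Quotient.mk_eq_zero X₀).2 hu
    simp [F, this]
  set g : StrongDual 𝕜 X := ∑ i ∈ Finset.range n, F (x i) • f i with hg
  obtain ⟨u, hu, hgu, hut⟩ := hnorm n g <| Submodule.sum_mem _ fun i hi =>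
    Submodule.smul_mem _ _ (Submodule.subset_span ⟨i, Finset.mem_range.1 hi, rfl⟩)
  have htail : ∑' j, t (j + n) ≤ ∑' j, t j :=
    tsum_comp_le_tsum_of_inj ht ht0 (add_left_injective n)
  have hgn : ‖g‖ ≤ C * (1 + M * ∑' j, t j) := hgu.trans <| by
    gcongr
    exact (norm_sum_smul_apply_le hX₀ hf hx ht hF hFX₀ hu hut).trans (by gcongr)
  have hgv : g v = φ (∑ i ∈ Finset.range n, f i v • X₀.mkQ (x i)) := by
    simp [hg, F, mul_comm]
  calc ‖∑ i ∈ Finset.range n, f i v • X₀.mkQ (x i)‖ = ‖g v‖ := by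
        rw [hgv, hφq, RCLike.norm_ofReal, abs_norm]
    _ ≤ C * (1 + M * ∑' j, t j) * ‖v‖ := g.le_of_opNorm_le hgn v

theorem isBasisWithConstLE_mkQ_of_norming [IsClosed (X₀ : Set X)] {D : Set X} (hD : Dense D)
    (hDf : ∀ d ∈ D, Summable fun j => ‖f j d‖) :
    IsBasisWithConstLE 𝕜 (fun m => X₀.mkQ (x m)) (C * (1 + M * ∑' j, t j)) := by
  have hM : 0 ≤ M := (norm_nonneg _).trans (hx 0)
  have hC' : 0 < C * (1 + M * ∑' j, t j) := by
    have : 0 ≤ ∑' j, t j := tsum_nonneg ht0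
    positivity
  have hle : ∀ i, X₀ ≤ (f i).toLinearMap.ker := fun i v hv => (hX₀ v).1 hv i
  refine isBasisWithConstLE_of_biorthogonal (f := fun i => X₀.liftQL (f i) (hle i)) hf
    (dense_span_mkQ hX₀ hf hD fun d hd => summable_coord_smul hx (hDf d hd)) fun n q => ?_
  rw [← div_le_iff₀' hC']
  refine QuotientAddGroup.le_norm_iff.2 ?_
  rintro v rfl
  rw [div_le_iff₀' hC']
  exact norm_sum_smul_mkQ_le hX₀ hf hx ht ht0 hC hnorm n v

end Quotient

section Norming

variable {𝕜 : Type*} [RCLike 𝕜] {X : Type*} [NormedAddCommGroup X] [NormedSpace 𝕜 X]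

theorem exists_finset_norming {ι : Type*} [Nonempty ι] (e : ι → StrongDual 𝕜 X)
    (V : Submodule 𝕜 X) [FiniteDimensional 𝕜 V] {C : ℝ}
    (h : ∀ v ∈ V, ‖v‖ = 1 → ∃ i, 1 < C * ‖e i v‖) :
    ∃ s : Finset ι, ∀ v ∈ V, ∃ i ∈ s, ‖v‖ ≤ C * ‖e i v‖ := by
  classical
  have : ProperSpace V := FiniteDimensional.proper 𝕜 V
  obtain ⟨s, hs⟩ := (isCompact_sphere (0 : V) 1).elim_finite_subcover
    (fun i => {v : V | 1 < C * ‖e i v‖})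
    (fun i => isOpen_lt continuous_const (by fun_prop))
    (fun v hv => by simpa using h v v.2 (by simpa using hv))
  refine ⟨insert (Classical.arbitrary ι) s, fun v hv => ?_⟩
  obtain rfl | hv0 := eq_or_ne v 0
  · exact ⟨_, Finset.mem_insert_self _ _, by simp⟩
  · obtain ⟨i, hi, hlt⟩ : ∃ i ∈ s, 1 < C * ‖e i (((‖v‖⁻¹ : ℝ) : 𝕜) • v)‖ := by
      simpa using hs (show (⟨((‖v‖⁻¹ : ℝ) : 𝕜) • v, V.smul_mem _ hv⟩ : V) ∈ Metric.sphere 0 1 by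
        simp [norm_smul, hv0])
    refine ⟨i, Finset.mem_insert_of_mem hi, ?_⟩
    rw [map_smul, norm_smul, RCLike.norm_ofReal, abs_inv, abs_norm, mul_left_comm,
      lt_inv_mul_iff₀ (norm_pos_iff.2 hv0), mul_one] at hlt
    exact hlt.le

theorem exists_finset_dual_norming (V : Submodule 𝕜 X) [FiniteDimensional 𝕜 V] {C : ℝ}
    (hC : 1 < C) : ∃ G : Finset (StrongDual 𝕜 X),
      ∀ v ∈ V, ∃ g ∈ G, ‖g‖ ≤ 1 ∧ ‖v‖ ≤ C * ‖g v‖ := by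
  classical
  have : Nonempty {g : StrongDual 𝕜 X // ‖g‖ ≤ 1} := ⟨0, by simp⟩
  obtain ⟨s, hs⟩ := exists_finset_norming
    (fun g : {g : StrongDual 𝕜 X // ‖g‖ ≤ 1} => g.1) V (C := C) fun v _ hv => by
      obtain ⟨g, hg, hgv⟩ := exists_dual_vector'' 𝕜 v
      exact ⟨⟨g, hg⟩, by simpa [hgv, hv] using hC⟩
  refine ⟨s.image Subtype.val, fun v hv => ?_⟩
  obtain ⟨g, hg, hgv⟩ := hs v hv
  exact ⟨g, Finset.mem_image_of_mem _ hg, g.2, hgv⟩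

theorem exists_finset_predual_norming (V : Submodule 𝕜 (StrongDual 𝕜 X)) [FiniteDimensional 𝕜 V]
    {C : ℝ} (hC : 1 < C) : ∃ S : Finset X,
      ∀ g ∈ V, ∃ u ∈ S, ‖u‖ ≤ 1 ∧ ‖g‖ ≤ C * ‖g u‖ := by
  classical
  have : Nonempty {u : X // ‖u‖ ≤ 1} := ⟨0, by simp⟩
  obtain ⟨s, hs⟩ := exists_finset_norming
    (fun u : {u : X // ‖u‖ ≤ 1} => ContinuousLinearMap.apply 𝕜 𝕜 u.1) V (C := C) fun g _ hg => by
      obtain ⟨u, hu, hgu⟩ := g.exists_lt_apply_of_lt_opNorm (hg ▸ inv_lt_one_of_one_lt₀ hC)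
      refine ⟨⟨u, hu.le⟩, ?_⟩
      rw [inv_lt_iff_one_lt_mul₀' (by positivity)] at hgu
      simpa using hgu
  refine ⟨s.image Subtype.val, fun g hg => ?_⟩
  obtain ⟨u, hu, hgu⟩ := hs g hg
  exact ⟨u, Finset.mem_image_of_mem _ hu, u.2, hgu⟩

end Norming

section Separated

theorem exists_ne_dist_lt_of_totallyBounded {ι α : Type*} [Infinite ι] [PseudoMetricSpace α]
    {f g : ι → α} {r ε : ℝ} (hfg : ∀ i, dist (f i) (g i) ≤ r)
    (hg : TotallyBounded (Set.range g)) (hrε : 2 * r < ε) :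
    ∃ i j, i ≠ j ∧ dist (f i) (f j) < ε := by
  obtain ⟨t, ht, hgt⟩ := Metric.totallyBounded_iff.1 hg ((ε - 2 * r) / 2) (by linarith)
  choose c hct hc using fun i => Set.mem_iUnion₂.1 (hgt ⟨i, rfl⟩)
  have := ht.to_subtype
  obtain ⟨i, j, hij, hcij⟩ :=
    Finite.exists_ne_map_eq_of_infinite fun i => (⟨c i, hct i⟩ : t)
  have hcij : c i = c j := congrArg Subtype.val hcij
  refine ⟨i, j, hij, ?_⟩
  calc dist (f i) (f j)
      ≤ dist (f i) (g i) + (dist (g i) (c i) + dist (c i) (g j)) + dist (g j) (f j) :=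
        (dist_triangle4 _ _ _ _).trans (by gcongr; exact dist_triangle _ _ _)
    _ < r + ((ε - 2 * r) / 2 + (ε - 2 * r) / 2) + r :=
        add_lt_add_of_lt_of_le (add_lt_add_of_le_of_lt (hfg i)
          (add_lt_add (hc i) (by rw [hcij, dist_comm]; exact hc j)))
          (by rw [dist_comm]; exact hfg j)
    _ = ε := by ring

variable {𝕜 : Type*} [RCLike 𝕜] {X : Type*} [NormedAddCommGroup X] [NormedSpace 𝕜 X]

theorem mem_span_of_forall_apply_eq_zero (F : Finset (StrongDual 𝕜 X)) {f : StrongDual 𝕜 X}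
    (hf : ∀ v, (∀ g ∈ F, g v = 0) → f v = 0) :
    f ∈ Submodule.span 𝕜 (F : Set (StrongDual 𝕜 X)) := by
  have hf' : (f : X →ₗ[𝕜] 𝕜) ∈ Submodule.span 𝕜
      (Set.range fun g : F => ((g : StrongDual 𝕜 X) : X →ₗ[𝕜] 𝕜)) := by
    refine mem_span_of_iInf_ker_le_ker fun v hv => hf v fun g hg => ?_
    simp only [Submodule.mem_iInf, LinearMap.mem_ker] at hv
    exact hv ⟨g, hg⟩
  obtain ⟨c, hc⟩ := (Submodule.mem_span_range_iff_exists_fun 𝕜).1 hf'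
  have hfc : f = ∑ g : F, c g • (g : StrongDual 𝕜 X) := by
    ext v
    simpa using (LinearMap.congr_fun hc v).symm
  exact hfc ▸ Submodule.sum_mem _ fun g _ => Submodule.smul_mem _ _ (Submodule.subset_span g.2)

theorem exists_mem_span_norm_sub_le {F : Finset (StrongDual 𝕜 X)} {f : StrongDual 𝕜 X} {r : ℝ}
    (hr : 0 ≤ r) (hf : ∀ v, (∀ g ∈ F, g v = 0) → ‖f v‖ ≤ r * ‖v‖) :
    ∃ g ∈ Submodule.span 𝕜 (F : Set (StrongDual 𝕜 X)), ‖f - g‖ ≤ r := by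
  let V : Submodule 𝕜 X := ⨅ g ∈ F, LinearMap.ker (g : X →ₗ[𝕜] 𝕜)
  have hV : ∀ v, v ∈ V ↔ ∀ g ∈ F, g v = 0 := by simp [V, Submodule.mem_iInf]
  obtain ⟨h, hhV, hh⟩ := exists_extension_norm_eq V (f.comp V.subtypeL)
  refine ⟨f - h, mem_span_of_forall_apply_eq_zero F fun v hv => ?_, ?_⟩
  · simpa [sub_eq_zero] using (hhV ⟨v, (hV v).2 hv⟩).symm
  · rw [sub_sub_cancel, hh]
    exact ContinuousLinearMap.opNorm_le_bound _ hr fun v => hf v ((hV v).1 v.2)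

theorem exists_norm_smul_eq_one_of_lt {f : StrongDual 𝕜 X} {r : ℝ} {v : X} (hr : 0 ≤ r)
    (h : r * ‖v‖ < ‖f v‖) : ∃ c : 𝕜, ‖c • v‖ = 1 ∧ (r : 𝕜) < f (c • v) := by
  have hfv : 0 < ‖f v‖ := lt_of_le_of_lt (by positivity) h
  have hv : 0 < ‖v‖ := norm_pos_iff.2 fun hv => by simp [hv] at hfv
  refine ⟨(‖f v‖ / ‖v‖ : ℝ) / f v, ?_, ?_⟩
  · rw [norm_smul, norm_div, RCLike.norm_ofReal, abs_of_pos (by positivity)]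
    field_simp
  · rw [map_smul, smul_eq_mul, div_mul_cancel₀ _ (norm_pos_iff.1 hfv), RCLike.ofReal_lt_ofReal]
    rwa [lt_div_iff₀ hv]

/-- If every member of the family were at most `r` on the common kernel of `F`, Hahn–Banach would
put each of them within `r` of the finite-dimensional span of `F`. -/
theorem exists_lt_apply_of_pairwise_lt_dist {ι : Type*} [Infinite ι] {f : ι → StrongDual 𝕜 X}
    {M ε r : ℝ} (hM : ∀ i, ‖f i‖ ≤ M) (hsep : Pairwise fun i j => ε < dist (f i) (f j))
    (hr : 0 ≤ r) (hrε : 2 * r < ε) (F : Finset (StrongDual 𝕜 X)) :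
    ∃ i, ∃ w, ‖w‖ = 1 ∧ (∀ g ∈ F, g w = 0) ∧ (r : 𝕜) < f i w := by
  by_contra! hcon
  have hsmall : ∀ i v, (∀ g ∈ F, g v = 0) → ‖f i v‖ ≤ r * ‖v‖ := fun i v hv => by
    by_contra! hlt
    obtain ⟨c, hc, hrc⟩ := exists_norm_smul_eq_one_of_lt hr hlt
    exact hcon i _ hc (fun g hg => by simp [hv g hg]) hrc
  choose g hgF hg using fun i => exists_mem_span_norm_sub_le hr (hsmall i)
  set E := Submodule.span 𝕜 (F : Set (StrongDual 𝕜 X))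
  have : FiniteDimensional 𝕜 E := FiniteDimensional.span_of_finite 𝕜 F.finite_toSet
  have : ProperSpace E := FiniteDimensional.proper 𝕜 E
  have hgM : ∀ i, ‖g i‖ ≤ M + r := fun i => by
    linarith [norm_le_norm_add_norm_sub (f i) (g i), hM i, hg i]
  have hgE : TotallyBounded (Set.range g) := by
    refine ((isCompact_closedBall (0 : E) (M + r)).image continuous_subtype_val).totallyBounded
      |>.subset ?_
    rintro _ ⟨i, rfl⟩
    exact ⟨⟨g i, hgF i⟩, mem_closedBall_zero_iff.2 (hgM i), rfl⟩
  obtain ⟨i, j, hij, hlt⟩ :=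
    exists_ne_dist_lt_of_totallyBounded (fun i => (dist_eq_norm _ _).trans_le (hg i)) hgE hrε
  exact (hsep hij).not_gt hlt

end Separated

section Preperfect

theorem exists_nonempty_preperfect_subset {α : Type*} [TopologicalSpace α] {S : Set α}
    [SecondCountableTopology S] (hS : ¬ S.Countable) : ∃ B ⊆ S, B.Nonempty ∧ Preperfect B := by
  obtain ⟨D, hD, hDne, -⟩ := exists_perfect_nonempty_of_isClosed_of_not_countable
    (isClosed_univ (X := S)) (by rwa [Set.countable_univ_iff])
  refine ⟨Subtype.val '' D, by simp, hDne.image _, ?_⟩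
  rintro _ ⟨x, hx, rfl⟩
  simpa using (hD.acc x hx).map continuous_subtype_val.continuousAt Subtype.val_injective

variable {𝕜 : Type*} [RCLike 𝕜] {Z : Type*} [NormedAddCommGroup Z] [NormedSpace 𝕜 Z]

theorem exists_forall_norm_le_of_isCompact_toWeakDual [CompleteSpace Z]
    {K : Set (StrongDual 𝕜 Z)} (hK : IsCompact (StrongDual.toWeakDual '' K)) :
    ∃ M, ∀ f ∈ K, ‖f‖ ≤ M := by
  obtain ⟨M, hM⟩ := banach_steinhaus (g := fun f : K => (f : StrongDual 𝕜 Z)) fun v => by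
    obtain ⟨C, hC⟩ := (hK.image (WeakDual.eval_continuous v)).isBounded.exists_norm_le
    exact ⟨C, fun f => hC _ ⟨_, ⟨f, f.2, rfl⟩, rfl⟩⟩
  exact ⟨M, fun f hf => hM ⟨f, hf⟩⟩

variable [TopologicalSpace.SeparableSpace Z]

theorem exists_nonempty_preperfect_toWeakDual {K S : Set (StrongDual 𝕜 Z)}
    (hK : IsCompact (StrongDual.toWeakDual '' K)) (hSK : S ⊆ K) (hS : ¬ S.Countable) :
    ∃ B ⊆ S, B.Nonempty ∧ Preperfect (StrongDual.toWeakDual '' B) := by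
  have := WeakDual.metrizable_of_isCompact 𝕜 Z _ hK
  have := isCompact_iff_compactSpace.1 hK
  let _ := TopologicalSpace.metrizableSpaceMetric (StrongDual.toWeakDual '' K)
  have : SecondCountableTopology (StrongDual.toWeakDual '' K) := inferInstance
  have : SecondCountableTopology (StrongDual.toWeakDual '' S) :=
    (IsEmbedding.inclusion (Set.image_mono hSK)).secondCountableTopology
  obtain ⟨B, hBS, hBne, hB⟩ := exists_nonempty_preperfect_subset fun h =>
    hS (Set.countable_of_injective_of_countable_image StrongDual.toWeakDual.injective.injOn h)
  obtain ⟨B, hBS', rfl⟩ := Set.subset_image_iff.1 hBS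
  exact ⟨B, hBS', Set.image_nonempty.1 hBne, hB⟩

theorem exists_preperfect_separated {W : Type*} [NormedAddCommGroup W] [NormedSpace 𝕜 W]
    (R : W →L[𝕜] Z) {K : Set (StrongDual 𝕜 Z)} (hK : IsCompact (StrongDual.toWeakDual '' K))
    {ε : ℝ} (hsep : ∃ A ⊆ (fun f : StrongDual 𝕜 Z => f.comp R) '' K,
      ¬ A.Countable ∧ Metric.IsSeparated (ENNReal.ofReal ε) A) {a : ℝ} (ha : 0 < a) :
    ∃ B ⊆ a • K, B.Nonempty ∧ Preperfect (StrongDual.toWeakDual '' B) ∧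
      B.Pairwise fun f g => a * ε < dist (f.comp R) (g.comp R) := by
  obtain ⟨A, hAK, hA, hsep⟩ := hsep
  obtain ⟨S, hSK, hS⟩ := Set.SurjOn.exists_bijOn_subset (f := fun f : StrongDual 𝕜 Z => f.comp R)
    (s := K) (t := A) hAK
  have hSc : ¬ (a • S).Countable := fun h => hA <| hS.image_eq ▸
    (Set.countable_of_injective_of_countable_image
      (smul_right_injective _ ha.ne').injOn h).image _
  have haK : IsCompact (StrongDual.toWeakDual '' (a • K)) := by
    convert hK.image (continuous_const_smul (a : 𝕜)) using 1
    rw [← Set.image_smul, Set.image_image, Set.image_image]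
    exact Set.image_congr fun f _ => by
      rw [RCLike.real_smul_eq_coe_smul (K := 𝕜) a f, map_smul]
  obtain ⟨B, hBS, hBne, hB⟩ :=
    exists_nonempty_preperfect_toWeakDual haK (Set.smul_set_mono hSK) hSc
  refine ⟨B, hBS.trans (Set.smul_set_mono hSK), hBne, hB, fun x hx y hy hxy => ?_⟩
  obtain ⟨f, hf, rfl⟩ := hBS hx
  obtain ⟨g, hg, rfl⟩ := hBS hy
  have hfg : f ≠ g := fun h => hxy (by rw [h])
  have hlt : ENNReal.ofReal ε < edist (f.comp R) (g.comp R) :=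
    hsep (hS.mapsTo hf) (hS.mapsTo hg) (hS.injOn.ne hf hg hfg)
  rw [edist_dist, ENNReal.ofReal_lt_ofReal_iff'] at hlt
  calc a * ε < ‖a‖ * dist (f.comp R) (g.comp R) := by
        rw [Real.norm_of_nonneg ha.le]
        exact mul_lt_mul_of_pos_left hlt.1 ha
    _ = dist ((a • f).comp R) ((a • g).comp R) := (dist_smul₀ a (f.comp R) (g.comp R)).symm

end Preperfect

section AbsConvex

theorem sum_mem_sum_smul_of_convex {E : Type*} [AddCommGroup E] [Module ℝ E] {K : Set E}
    (hK : Convex ℝ K) (hK0 : (0 : E) ∈ K) {ι : Type*} {s : Finset ι} {e : ι → E} {t : ι → ℝ}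
    (ht : ∀ i ∈ s, 0 ≤ t i) (he : ∀ i ∈ s, e i ∈ t i • K) : ∑ i ∈ s, e i ∈ (∑ i ∈ s, t i) • K := by
  classical
  induction s using Finset.induction_on with
  | empty => simpa using Set.smul_mem_smul_set (a := (0 : ℝ)) hK0
  | insert i s hi ih =>
    rw [Finset.forall_mem_insert] at ht he
    rw [Finset.sum_insert hi, Finset.sum_insert hi, hK.add_smul ht.1 (Finset.sum_nonneg ht.2)]
    exact Set.add_mem_add he.1 (ih ht.2 he.2)

variable {𝕜 : Type*} [RCLike 𝕜] {E : Type*} [AddCommGroup E] [Module 𝕜 E] [Module ℝ E]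
  [IsScalarTower ℝ 𝕜 E] {K : Set E}

theorem smul_mem_smul_of_norm_le (hKb : Balanced 𝕜 K) {c : 𝕜} {κ : ℝ} (hκ : 0 < κ) (hc : ‖c‖ ≤ κ)
    {y : E} (hy : y ∈ K) : c • y ∈ κ • K := by
  refine ⟨κ⁻¹ • c • y, ?_, smul_inv_smul₀ hκ.ne' _⟩
  rw [← smul_assoc]
  refine hKb.smul_mem ?_ hy
  rwa [norm_smul, norm_inv, Real.norm_of_nonneg hκ.le, inv_mul_le_one₀ hκ]

variable (hKc : Convex ℝ K) (hKb : Balanced 𝕜 K) (hK0 : (0 : E) ∈ K)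
include hKc hKb hK0

theorem eventually_smul_mem_smul_of_mem_span {α : Type*} {L : Filter α} {c : α → 𝕜}
    (hc : Tendsto c L (𝓝 0)) {y : E} (hy : y ∈ Submodule.span 𝕜 K) {κ : ℝ} (hκ : 0 < κ) :
    ∀ᶠ a in L, c a • y ∈ κ • K := by
  induction hy using Submodule.span_induction generalizing c κ with
  | mem y hy =>
    have hc' : Tendsto (fun a => ‖c a‖) L (𝓝 0) := by simpa using hc.norm
    filter_upwards [hc'.eventually (eventually_le_nhds hκ)] with a ha
    exact smul_mem_smul_of_norm_le hKb hκ ha hy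
  | zero => simpa using Eventually.of_forall fun _ => Set.zero_mem_smul_set hK0
  | add u v _ _ hu hv =>
    filter_upwards [hu hc (half_pos hκ), hv hc (half_pos hκ)] with a hau hav
    rw [smul_add, ← add_halves κ, hKc.add_smul (half_pos hκ).le (half_pos hκ).le]
    exact Set.add_mem_add hau hav
  | smul d v _ hv =>
    simpa [smul_smul] using hv (c := fun a => c a * d) (by simpa using hc.mul_const d) hκ

theorem eventually_sum_smul_mem_smul_of_mem_span {α : Type*} {L : Filter α} {ι : Type*}
    {s : Finset ι} {c : ι → α → 𝕜} {y : ι → E} (hc : ∀ i ∈ s, Tendsto (c i) L (𝓝 0))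
    (hy : ∀ i ∈ s, y i ∈ Submodule.span 𝕜 K) {κ : ℝ} (hκ : 0 < κ) :
    ∀ᶠ a in L, ∑ i ∈ s, c i a • y i ∈ κ • K := by
  classical
  induction s using Finset.induction_on generalizing κ with
  | empty => simpa using Eventually.of_forall fun _ => Set.zero_mem_smul_set hK0
  | insert i s hi ih =>
    rw [Finset.forall_mem_insert] at hc hy
    filter_upwards [eventually_smul_mem_smul_of_mem_span hKc hKb hK0 hc.1 hy.1 (half_pos hκ),
      ih hc.2 hy.2 (half_pos hκ)] with a hai has
    rw [Finset.sum_insert hi, ← add_halves κ, hKc.add_smul (half_pos hκ).le (half_pos hκ).le]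
    exact Set.add_mem_add hai has

end AbsConvex

section Orthogonalize

variable {𝕜 : Type*} [RCLike 𝕜] {Z : Type*} [NormedAddCommGroup Z] [NormedSpace 𝕜 Z]
  {ι : Type*} [Fintype ι]

/-- Subtracts from `f` its components along the functionals `y i`, read off at the vectors `u i`.
When `y i (u j) = 0` for `i ≠ j` and `y i (u i) ≠ 0`, the result vanishes at every `u j`. -/
noncomputable def orthogonalize (y : ι → StrongDual 𝕜 Z) (u : ι → Z) (f : StrongDual 𝕜 Z) :
    StrongDual 𝕜 Z :=
  f - ∑ i, (f (u i) / y i (u i)) • y i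

variable {y : ι → StrongDual 𝕜 Z} {u : ι → Z}

theorem orthogonalize_apply_eq_zero (hy : Pairwise fun i j => y i (u j) = 0)
    (hyu : ∀ i, y i (u i) ≠ 0) (f : StrongDual 𝕜 Z) (j : ι) : orthogonalize y u f (u j) = 0 := by
  have hsum : ∑ i, f (u i) / y i (u i) * y i (u j) = f (u j) := by
    rw [Fintype.sum_eq_single j fun i hi => by rw [hy hi, mul_zero], div_mul_cancel₀ _ (hyu j)]
  simp [orthogonalize, hsum]

theorem orthogonalize_apply_of_forall_eq_zero {v : Z} (hv : ∀ i, y i v = 0)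
    (f : StrongDual 𝕜 Z) : orthogonalize y u f v = f v := by
  simp [orthogonalize, hv]

variable {α : Type*} {L : Filter α} {f : α → StrongDual 𝕜 Z}
  (hf : ∀ v, Tendsto (fun a => f a v) L (𝓝 0))
include hf

theorem tendsto_orthogonalize_apply (v : Z) :
    Tendsto (fun a => orthogonalize y u (f a) v) L (𝓝 0) := by
  have hsum : Tendsto (fun a => ∑ i, f a (u i) / y i (u i) * y i v) L (𝓝 0) := by
    simpa using tendsto_finsetSum (Finset.univ : Finset ι) fun i _ =>
      ((hf (u i)).div_const (y i (u i))).mul_const (y i v)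
  simpa [orthogonalize] using (hf v).sub hsum

theorem eventually_orthogonalize_sub_mem {K : Set (StrongDual 𝕜 Z)} (hKc : Convex ℝ K)
    (hKb : Balanced 𝕜 K) (hK0 : 0 ∈ K) (hy : ∀ i, y i ∈ Submodule.span 𝕜 K) {κ : ℝ} (hκ : 0 < κ) :
    ∀ᶠ a in L, orthogonalize y u (f a) - f a ∈ κ • K := by
  have hc : ∀ i ∈ Finset.univ, Tendsto (fun a => -(f a (u i) / y i (u i))) L (𝓝 0) := fun i _ => by
    simpa using ((hf (u i)).div_const (y i (u i))).neg
  filter_upwards [eventually_sum_smul_mem_smul_of_mem_span hKc hKb hK0 hc (fun i _ => hy i) hκ]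
    with a ha
  rw [orthogonalize, sub_sub_cancel_left, ← Finset.sum_neg_distrib]
  simpa only [neg_smul] using ha

end Orthogonalize

section Extension

variable {𝕜 : Type*} [RCLike 𝕜] {Z : Type*} [NormedAddCommGroup Z] [NormedSpace 𝕜 Z]
  {W : Type*} [NormedAddCommGroup W] [NormedSpace 𝕜 W] {R : W →L[𝕜] Z}
  {B : Set (StrongDual 𝕜 Z)} {M ε r : ℝ}

theorem exists_lt_apply_of_infinite (hM : ∀ f ∈ B, ‖f‖ ≤ M)
    (hsep : B.Pairwise fun f g => ε < dist (f.comp R) (g.comp R)) (hr : 0 ≤ r) (hrε : 2 * r < ε)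
    (F : Finset (StrongDual 𝕜 W)) {A : Set (StrongDual 𝕜 Z)} (hAB : A ⊆ B) (hA : A.Infinite) :
    ∃ x ∈ A, ∃ w : W, ‖w‖ = 1 ∧ (∀ g ∈ F, g w = 0) ∧ (r : 𝕜) < x (R w) := by
  have := hA.to_subtype
  obtain ⟨x, w, hw⟩ := exists_lt_apply_of_pairwise_lt_dist
    (f := fun x : A => (x : StrongDual 𝕜 Z).comp R) (M := M * ‖R‖)
    (fun x => (ContinuousLinearMap.opNorm_comp_le _ _).trans
      (mul_le_mul_of_nonneg_right (hM x (hAB x.2)) (norm_nonneg R)))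
    (fun x y hxy => hsep (hAB x.2) (hAB y.2) (Subtype.coe_ne_coe.2 hxy)) hr hrε F
  exact ⟨x, x.2, w, hw⟩

theorem infinite_setOf_of_preperfect (hB : Preperfect (StrongDual.toWeakDual '' B))
    {x₀ : StrongDual 𝕜 Z} (hx₀ : x₀ ∈ B) {p : StrongDual 𝕜 Z → Prop}
    (hp : ∀ᶠ x in comap StrongDual.toWeakDual (𝓝 (StrongDual.toWeakDual x₀)), p x) :
    {x ∈ B | p x}.Infinite := by
  rw [eventually_comap] at hp
  have hinf := Set.Infinite.of_accPt ((hB _ ⟨x₀, hx₀, rfl⟩).nhds_inter hp)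
  refine (hinf.mono ?_).of_image StrongDual.toWeakDual
  rintro _ ⟨hx, x, hxB, rfl⟩
  exact ⟨x, ⟨hxB, hx x rfl⟩, rfl⟩

/-- A point `x` of `B` close to `x₀` is moved by a small multiple of `K` to make `x - x₀`
orthogonal to the earlier vectors; the new vector is chosen in the kernel of the earlier
functionals. -/
theorem exists_orthogonal_extension (hM : ∀ f ∈ B, ‖f‖ ≤ M)
    (hsep : B.Pairwise fun f g => ε < dist (f.comp R) (g.comp R)) (hr : 0 ≤ r) (hrε : 2 * r < ε)
    (hB : Preperfect (StrongDual.toWeakDual '' B)) {K : Set (StrongDual 𝕜 Z)}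
    (hKc : Convex ℝ K) (hKb : Balanced 𝕜 K) (hK0 : 0 ∈ K) {x₀ : StrongDual 𝕜 Z} (hx₀ : x₀ ∈ B)
    {ι : Type*} [Finite ι] {y : ι → StrongDual 𝕜 Z} {w : ι → W}
    (hy : Pairwise fun i j => y i (R (w j)) = 0) (hyw : ∀ i, y i (R (w i)) ≠ 0)
    (hyK : ∀ i, y i ∈ Submodule.span 𝕜 K) (F : Finset (StrongDual 𝕜 W)) (U : Finset Z)
    {κ : ℝ} (hκ : 0 < κ) :
    ∃ x ∈ B, ∃ (y' : StrongDual 𝕜 Z) (w' : W), ‖w'‖ = 1 ∧ (r : 𝕜) < y' (R w') ∧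
      (∀ i, y' (R (w i)) = 0) ∧ (∀ i, y i (R w') = 0) ∧ (∀ g ∈ F, g w' = 0) ∧
      (∀ u ∈ U, ‖y' u‖ ≤ κ) ∧ y' - (x - x₀) ∈ κ • K := by
  classical
  have := Fintype.ofFinite ι
  let ψ : StrongDual 𝕜 Z → StrongDual 𝕜 Z := fun x => orthogonalize y (fun i => R (w i)) (x - x₀)
  have hlim : ∀ v, Tendsto (fun x : StrongDual 𝕜 Z => (x - x₀) v)
      (comap StrongDual.toWeakDual (𝓝 (StrongDual.toWeakDual x₀))) (𝓝 0) := fun v => by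
    have hv : Tendsto (fun x : StrongDual 𝕜 Z => x v)
        (comap StrongDual.toWeakDual (𝓝 (StrongDual.toWeakDual x₀))) (𝓝 (x₀ v)) :=
      ((WeakDual.eval_continuous v).tendsto (StrongDual.toWeakDual x₀)).comp tendsto_comap
    simpa using hv.sub_const (x₀ v)
  have hsmall : ∀ᶠ x in comap StrongDual.toWeakDual (𝓝 (StrongDual.toWeakDual x₀)),
      ∀ u ∈ U, ‖ψ x u‖ ≤ κ := (eventually_all_finset U).2 fun u _ => by
    have := (tendsto_orthogonalize_apply (y := y) (u := fun i => R (w i)) hlim u).norm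
    exact this.eventually (eventually_le_nhds (by simpa using hκ))
  obtain ⟨x, ⟨hxB, hxU, hxK⟩, w', hw', hF, hxw⟩ := exists_lt_apply_of_infinite hM hsep hr hrε
    (insert (x₀.comp R) (F ∪ Finset.univ.image fun i => (y i).comp R)) (Set.sep_subset _ _)
    (infinite_setOf_of_preperfect hB hx₀
      (hsmall.and (eventually_orthogonalize_sub_mem hlim hKc hKb hK0 hyK hκ)))
  simp only [Finset.forall_mem_insert, Finset.forall_mem_union, Finset.forall_mem_image,
    Finset.mem_univ, true_imp_iff, ContinuousLinearMap.comp_apply] at hF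
  obtain ⟨hx₀w, hFw, hyw'⟩ := hF
  refine ⟨x, hxB, ψ x, w', hw', ?_, orthogonalize_apply_eq_zero hy hyw _, hyw', hFw, hxU, hxK⟩
  rwa [orthogonalize_apply_of_forall_eq_zero hyw', sub_apply, hx₀w, sub_zero]

end Extension

section Recursion

theorem exists_seq_forall_of_forall_exists {α : Type*} [Nonempty α]
    (P : ∀ n, (Fin n → α) → α → Prop)
    (h : ∀ (n : ℕ) (f : ℕ → α), (∀ k < n, P k (fun i => f i) (f k)) → ∃ a, P n (fun i => f i) a) :
    ∃ f : ℕ → α, ∀ n, P n (fun i => f i) (f n) := by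
  let f : ℕ → α := Nat.strongRec fun n h => Classical.epsilon (P n fun i => h i i.2)
  have hf (n : ℕ) : f n = Classical.epsilon (P n fun i => f i) :=
    Nat.strongRec_eq _ n
  refine ⟨f, fun n => ?_⟩
  induction n using Nat.strong_induction_on with
  | h n ih =>
    rw [hf]
    exact Classical.epsilon_spec (h n f ih)

variable (𝕜 : Type*) [RCLike 𝕜] (W : Type*) [NormedAddCommGroup W] (Z : Type*)
  [NormedAddCommGroup Z] [NormedSpace 𝕜 Z]

/-- One step of the construction: the point `x` of the separated set attached to a node, the
increment `y`, which is `x` minus the point attached to the parent node up to a small error, and the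
vector `w`, on which `y` is large. -/
structure Stage where
  x : StrongDual 𝕜 Z
  y : StrongDual 𝕜 Z
  w : W

instance : Nonempty (Stage 𝕜 W Z) := ⟨⟨0, 0, 0⟩⟩

variable {𝕜 W Z} [NormedSpace 𝕜 W]

/-- The requirements on the `n`-th stage `a`, given the earlier stages `h`. Here `p n` is the
parent of `n`, `G` and `S` choose norming sets for finite-dimensional subspaces of `W` and of the
dual of `Z`, `d` is a dense sequence, and `t` bounds the errors. -/
structure Stage.IsNext (R : W →L[𝕜] Z) (B K : Set (StrongDual 𝕜 Z)) (p : ℕ → ℕ)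
    (G : Submodule 𝕜 W → Finset (StrongDual 𝕜 W)) (S : Submodule 𝕜 (StrongDual 𝕜 Z) → Finset Z)
    (d : ℕ → Z) (r : ℝ) (t : ℕ → ℝ) (n : ℕ) (h : Fin n → Stage 𝕜 W Z) (a : Stage 𝕜 W Z) :
    Prop where
  x_mem : a.x ∈ B
  norm_w : ‖a.w‖ = 1
  lt_apply : (r : 𝕜) < a.y (R a.w)
  apply_earlier : ∀ i, a.y (R (h i).w) = 0
  earlier_apply : ∀ i, (h i).y (R a.w) = 0
  norming_apply : ∀ i : Fin n,
    ∀ g ∈ G (Submodule.span 𝕜 (Set.range fun j : Fin (i + 1) => (h (j.castLE i.2)).w)), g a.w = 0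
  norm_apply_norming_le : ∀ i : Fin n,
    ∀ u ∈ S (Submodule.span 𝕜 (Set.range fun j : Fin (i + 1) => (h (j.castLE i.2)).y)),
      ‖a.y u‖ ≤ t n
  norm_apply_dense_le : ∀ i : Fin n, ‖a.y (d i)‖ ≤ t n
  y_zero : n = 0 → a.y = a.x
  y_sub_mem : ∀ i : Fin n, i = p n → a.y - (a.x - (h i).x) ∈ t n • K

namespace Stage

variable {R : W →L[𝕜] Z} {B K : Set (StrongDual 𝕜 Z)} {p : ℕ → ℕ}
  {G : Submodule 𝕜 W → Finset (StrongDual 𝕜 W)} {S : Submodule 𝕜 (StrongDual 𝕜 Z) → Finset Z}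
  {d : ℕ → Z} {M ε r : ℝ} {t : ℕ → ℝ} {f : ℕ → Stage 𝕜 W Z}

theorem pairwise_apply_eq_zero {s : Set ℕ}
    (hf : ∀ k ∈ s, IsNext R B K p G S d r t k (fun i => f i) (f k)) :
    s.Pairwise fun i j => (f i).y (R (f j).w) = 0 := fun i hi j hj hij =>
  hij.lt_or_gt.elim (fun h => (hf j hj).earlier_apply ⟨i, h⟩) fun h =>
    (hf i hi).apply_earlier ⟨j, h⟩

theorem y_mem_span (hB : B ⊆ Submodule.span 𝕜 K) (hp : ∀ n ≠ 0, p n < n) {n : ℕ}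
    (hf : ∀ k ≤ n, IsNext R B K p G S d r t k (fun i => f i) (f k)) :
    (f n).y ∈ Submodule.span 𝕜 K := by
  have hx (k : ℕ) (hk : k ≤ n) : (f k).x ∈ Submodule.span 𝕜 K := hB (hf k hk).x_mem
  rcases eq_or_ne n 0 with hn | hn
  · rw [(hf n le_rfl).y_zero hn]
    exact hx n le_rfl
  · obtain ⟨k, hk, hky⟩ := (hf n le_rfl).y_sub_mem ⟨p n, hp n hn⟩ rfl
    rw [← sub_add_cancel (f n).y ((f n).x - (f (p n)).x), ← hky]
    refine add_mem ?_ (sub_mem (hx n le_rfl) (hx (p n) (hp n hn).le))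
    exact Submodule.smul_of_tower_mem _ (t n) (Submodule.subset_span hk)

theorem exists_isNext_zero (hM : ∀ f ∈ B, ‖f‖ ≤ M)
    (hsep : B.Pairwise fun f g => ε < dist (f.comp R) (g.comp R)) (hr : 0 ≤ r) (hrε : 2 * r < ε)
    (hB : B.Infinite) (h : Fin 0 → Stage 𝕜 W Z) : ∃ a, IsNext R B K p G S d r t 0 h a := by
  obtain ⟨x, hx, w, hw, -, hxw⟩ := exists_lt_apply_of_infinite hM hsep hr hrε ∅ subset_rfl hB
  exact ⟨⟨x, x, w⟩, hx, hw, hxw, nofun, nofun, nofun, nofun, nofun, fun _ => rfl, nofun⟩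

theorem exists_isNext (hM : ∀ f ∈ B, ‖f‖ ≤ M)
    (hsep : B.Pairwise fun f g => ε < dist (f.comp R) (g.comp R)) (hr : 0 ≤ r) (hrε : 2 * r < ε)
    (hB : Preperfect (StrongDual.toWeakDual '' B)) (hBK : B ⊆ Submodule.span 𝕜 K)
    (hKc : Convex ℝ K) (hKb : Balanced 𝕜 K) (hK0 : 0 ∈ K) (hp : ∀ n ≠ 0, p n < n) {n : ℕ}
    (ht : 0 < t n) (hn : n ≠ 0)
    (hf : ∀ k < n, IsNext R B K p G S d r t k (fun i => f i) (f k)) :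
    ∃ a, IsNext R B K p G S d r t n (fun i => f i) a := by
  classical
  let F : Finset (StrongDual 𝕜 W) := Finset.univ.biUnion fun i : Fin n =>
    G (Submodule.span 𝕜 (Set.range fun j : Fin (i + 1) => (f j).w))
  let U : Finset Z := (Finset.univ.biUnion fun i : Fin n =>
    S (Submodule.span 𝕜 (Set.range fun j : Fin (i + 1) => (f j).y))) ∪
      Finset.univ.image fun i : Fin n => d i
  have hne (i : Fin n) : (f i).y (R (f i).w) ≠ 0 := fun h0 => by
    have h := (hf i i.2).lt_apply
    rw [h0, ← RCLike.ofReal_zero, RCLike.ofReal_lt_ofReal] at h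
    exact hr.not_gt h
  obtain ⟨x, hx, y, w, hw, hyw, hyf, hfw, hF, hU, hyx⟩ := exists_orthogonal_extension hM hsep hr hrε
    hB hKc hKb hK0 (hf (p n) (hp n hn)).x_mem (y := fun i : Fin n => (f i).y)
    (w := fun i : Fin n => (f i).w)
    (fun i j hij => pairwise_apply_eq_zero (s := Set.Iio n) hf i.2 j.2 (Fin.val_ne_of_ne hij)) hne
    (fun i => y_mem_span hBK hp fun k hk => hf k (hk.trans_lt i.2)) F U ht
  simp only [F, U, Finset.forall_mem_union, Finset.forall_mem_image, Finset.mem_biUnion,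
    Finset.mem_univ, true_and, true_imp_iff, forall_exists_index] at hF hU
  obtain ⟨hUS, hUd⟩ := hU
  exact ⟨⟨x, y, w⟩, hx, hw, hyw, hyf, hfw, fun i g hg => hF g i hg, fun i u hu => hUS u i hu,
    @hUd, fun h => absurd h hn, fun i hi => by simpa only [hi] using hyx⟩

theorem exists_seq_isNext (hM : ∀ f ∈ B, ‖f‖ ≤ M)
    (hsep : B.Pairwise fun f g => ε < dist (f.comp R) (g.comp R)) (hr : 0 ≤ r) (hrε : 2 * r < ε)
    (hB0 : B.Nonempty) (hB : Preperfect (StrongDual.toWeakDual '' B))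
    (hBK : B ⊆ Submodule.span 𝕜 K) (hKc : Convex ℝ K) (hKb : Balanced 𝕜 K) (hK0 : 0 ∈ K)
    (hp : ∀ n ≠ 0, p n < n) (ht : ∀ n, 0 < t n) :
    ∃ f : ℕ → Stage 𝕜 W Z, ∀ n, IsNext R B K p G S d r t n (fun i => f i) (f n) := by
  refine exists_seq_forall_of_forall_exists _ fun n f hf => ?_
  rcases eq_or_ne n 0 with rfl | hn
  · obtain ⟨x, hx⟩ := hB0
    have hinf := infinite_setOf_of_preperfect hB hx (Eventually.of_forall fun _ => trivial)
    exact exists_isNext_zero hM hsep hr hrε (hinf.mono (Set.sep_subset _ _)) _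
  · exact exists_isNext hM hsep hr hrε hB hBK hKc hKb hK0 hp (ht n) hn hf

end Stage

end Recursion

section RootedPath

/-- `C` is a path from the root `0` in the tree on `ℕ` in which `p n` is the parent of `n ≠ 0`, for
an enumeration listing parents before their children. -/
def IsRootedPath (p : ℕ → ℕ) (C : Set ℕ) : Prop :=
  ∀ n ∈ C, n ≠ 0 → IsGreatest (C ∩ Set.Iio n) (p n)

namespace IsRootedPath

variable {p : ℕ → ℕ} {C : Set ℕ} (hC : IsRootedPath p C)
include hC

theorem sum_sub_parent {E : Type*} [AddCommGroup E] (x : ℕ → E) {m k : ℕ}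
    (hk : IsGreatest (C ∩ Set.Iio m) k) :
    ∑ j ∈ Finset.range m, C.indicator (fun n => if n = 0 then x 0 else x n - x (p n)) j = x k := by
  induction m generalizing k with
  | zero => exact absurd hk.1.2 k.not_lt_zero
  | succ m ih =>
    rw [Finset.sum_range_succ]
    by_cases hm : m ∈ C
    · have hkm : k = m := le_antisymm (Nat.le_of_lt_succ hk.1.2) (hk.2 ⟨hm, m.lt_succ_self⟩)
      rw [Set.indicator_of_mem hm, hkm]
      rcases eq_or_ne m 0 with rfl | hm0
      · simp
      · rw [if_neg hm0, ih (hC m hm hm0), add_sub_cancel]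
    · have hlt (j : ℕ) (hj : j ∈ C) (hjm : j < m + 1) : j < m :=
        (Nat.le_of_lt_succ hjm).lt_of_ne fun h => hm (h ▸ hj)
      rw [Set.indicator_of_notMem hm, add_zero]
      exact ih ⟨⟨hk.1.1, hlt k hk.1.1 hk.1.2⟩, fun j hj => hk.2 ⟨hj.1, hj.2.trans m.lt_succ_self⟩⟩

theorem sum_indicator_mem {E : Type*} [AddCommGroup E] [Module ℝ E] {K : Set E} (hKc : Convex ℝ K)
    (hK0 : 0 ∈ K) {x y : ℕ → E} {a : ℝ} {t : ℕ → ℝ} (ha : 0 ≤ a) (ht0 : ∀ n, 0 ≤ t n)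
    (ht : Summable t) (hat : a + ∑' n, t n ≤ 1) (hx : ∀ n, x n ∈ a • K)
    (hy : ∀ n, y n - (if n = 0 then x 0 else x n - x (p n)) ∈ t n • K) (m : ℕ) :
    ∑ j ∈ Finset.range m, C.indicator y j ∈ K := by
  set z : ℕ → E := fun n => if n = 0 then x 0 else x n - x (p n)
  have hz : ∑ j ∈ Finset.range m, C.indicator z j ∈ a • K := by
    rcases (C ∩ Set.Iio m).eq_empty_or_nonempty with hm | hm
    · rw [Finset.sum_eq_zero fun j hj => Set.indicator_of_notMem
        (fun hjC => hm.subset ⟨hjC, Finset.mem_range.1 hj⟩) z]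
      exact Set.zero_mem_smul_set hK0
    · obtain ⟨k, hk⟩ := BddAbove.exists_isGreatest_of_nonempty
        (bddAbove_Iio.mono Set.inter_subset_right) hm
      exact hC.sum_sub_parent x hk ▸ hx k
  have hyz : ∑ j ∈ Finset.range m, C.indicator (y - z) j ∈ (∑ j ∈ Finset.range m, t j) • K :=
    sum_mem_sum_smul_of_convex hKc hK0 (fun j _ => ht0 j) fun j _ => by
      by_cases hj : j ∈ C
      · rw [Set.indicator_of_mem hj]
        exact hy j
      · simpa only [Set.indicator_of_notMem hj] using Set.zero_mem_smul_set hK0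
  have hsum : ∑ j ∈ Finset.range m, C.indicator y j ∈ (a + ∑ j ∈ Finset.range m, t j) • K := by
    rw [hKc.add_smul ha (Finset.sum_nonneg fun j _ => ht0 j)]
    convert Set.add_mem_add hz hyz
    rw [← Finset.sum_add_distrib]
    simp only [← Pi.add_apply, ← Set.indicator_add', add_sub_cancel]
  obtain ⟨k, hk, hkeq⟩ := hsum
  rw [← hkeq]
  exact hKc.smul_mem_of_zero_mem hK0 hk
    ⟨add_nonneg ha (Finset.sum_nonneg fun j _ => ht0 j),
      (add_le_add_right (ht.sum_le_tsum _ fun j _ => ht0 j) a).trans hat⟩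

end IsRootedPath

end RootedPath

section Sequence

namespace Stage

variable {𝕜 : Type*} [RCLike 𝕜] {W : Type*} [NormedAddCommGroup W] [NormedSpace 𝕜 W] {Z : Type*}
  [NormedAddCommGroup Z] [NormedSpace 𝕜 Z] {R : W →L[𝕜] Z} {B K : Set (StrongDual 𝕜 Z)}
  {p : ℕ → ℕ} {G : Submodule 𝕜 W → Finset (StrongDual 𝕜 W)}
  {S : Submodule 𝕜 (StrongDual 𝕜 Z) → Finset Z} {d : ℕ → Z} {r : ℝ} {t : ℕ → ℝ}

theorem IsNext.le_norm_apply {n : ℕ} {h : Fin n → Stage 𝕜 W Z} {a : Stage 𝕜 W Z}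
    (ha : IsNext R B K p G S d r t n h a) : r ≤ ‖a.y (R a.w)‖ :=
  calc r = RCLike.re (r : 𝕜) := (RCLike.ofReal_re r).symm
    _ ≤ RCLike.re (a.y (R a.w)) := (RCLike.lt_iff_re_im.1 ha.lt_apply).1.le
    _ ≤ ‖a.y (R a.w)‖ := RCLike.re_le_norm _

/-- The multiple of the increment of `a` that equals `1` at the image of the vector of `a`. -/
noncomputable def coord (R : W →L[𝕜] Z) (a : Stage 𝕜 W Z) : StrongDual 𝕜 Z :=
  (a.y (R a.w))⁻¹ • a.y

variable {f : ℕ → Stage 𝕜 W Z} (hf : ∀ n, IsNext R B K p G S d r t n (fun i => f i) (f n))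
include hf

theorem pairwise_apply_eq_zero_of_forall : Pairwise fun i j => (f i).y (R (f j).w) = 0 := by
  simpa [Set.pairwise_univ] using pairwise_apply_eq_zero (s := Set.univ) fun k _ => hf k

theorem summable_norm_apply (ht : Summable t) (k : ℕ) : Summable fun j => ‖(f j).y (d k)‖ :=
  ht.of_norm_bounded_eventually_nat <| by
    filter_upwards [eventually_gt_atTop k] with j hj
    simpa using (hf j).norm_apply_dense_le ⟨k, hj⟩

theorem y_sub_mem_smul (hK0 : 0 ∈ K) (hp : ∀ n ≠ 0, p n < n) (n : ℕ) :
    (f n).y - (if n = 0 then (f 0).x else (f n).x - (f (p n)).x) ∈ t n • K := by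
  split_ifs with hn
  · subst hn
    rw [(hf 0).y_zero rfl, sub_self]
    exact Set.zero_mem_smul_set hK0
  · exact (hf n).y_sub_mem ⟨p n, hp n hn⟩ rfl

variable (hr : 0 < r)
include hr

theorem apply_ne_zero (n : ℕ) : (f n).y (R (f n).w) ≠ 0 :=
  norm_pos_iff.1 (hr.trans_le (hf n).le_norm_apply)

theorem coord_apply (i j : ℕ) : coord R (f i) (R (f j).w) = if i = j then 1 else 0 := by
  rcases eq_or_ne i j with rfl | hij
  · simp [coord, inv_mul_cancel₀ (apply_ne_zero hf hr i)]
  · simp [coord, hij, pairwise_apply_eq_zero_of_forall hf hij]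

theorem norm_coord_apply_le (n : ℕ) (v : Z) : ‖coord R (f n) v‖ ≤ ‖(f n).y v‖ / r := by
  rw [coord, smul_apply, norm_smul, norm_inv, inv_mul_eq_div]
  exact div_le_div_of_nonneg_left (norm_nonneg _) hr (hf n).le_norm_apply

theorem mem_commonKer_iff (v : Z) :
    v ∈ commonKer (fun n => (f n).y) ↔ ∀ n, coord R (f n) v = 0 := by
  simp [commonKer, coord, apply_ne_zero hf hr]

theorem isBasicWithConstLE {C : ℝ} (hC : 0 ≤ C)
    (hG : ∀ V : Submodule 𝕜 W, FiniteDimensional 𝕜 V →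
      ∀ v ∈ V, ∃ g ∈ G V, ‖g‖ ≤ 1 ∧ ‖v‖ ≤ C * ‖g v‖) :
    IsBasicWithConstLE 𝕜 (fun n => (f n).w) C := by
  refine isBasicWithConstLE_of_norming (f := fun n => (coord R (f n)).comp R)
    (coord_apply hf hr) hC fun n v hv => ?_
  rw [← Fin.range_val, ← Set.range_comp] at hv
  rcases n with - | n
  · have hv0 : v = 0 := by simpa using hv
    exact ⟨0, by simp [hv0]⟩
  · obtain ⟨g, hg, hg1, hgv⟩ := hG _ (.span_of_finite 𝕜 (Set.finite_range _)) v hv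
    exact ⟨g, hg1, hgv, fun j hj => (hf j).norming_apply ⟨n, hj⟩ g hg⟩

theorem isBasisWithConstLE_mkQ [CompleteSpace Z] (ht : Summable t) (ht0 : ∀ n, 0 ≤ t n)
    (hd : DenseRange d) {C : ℝ} (hC : 0 < C)
    (hS : ∀ V : Submodule 𝕜 (StrongDual 𝕜 Z), FiniteDimensional 𝕜 V →
      ∀ g ∈ V, ∃ u ∈ S V, ‖u‖ ≤ 1 ∧ ‖g‖ ≤ C * ‖g u‖) :
    IsBasisWithConstLE 𝕜 (fun n => (commonKer fun n => (f n).y).mkQ (R (f n).w))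
      (C * (1 + ‖R‖ * ∑' n, t n / r)) := by
  have hx (n : ℕ) : ‖R (f n).w‖ ≤ ‖R‖ := R.unit_le_opNorm _ (hf n).norm_w.le
  refine isBasisWithConstLE_mkQ_of_norming (mem_commonKer_iff hf hr) (coord_apply hf hr) hx
    (ht.div_const r) (fun n => div_nonneg (ht0 n) hr.le) hC (fun n g hg => ?_) hd ?_
  · rcases n with - | n
    · have hg0 : g = 0 := by simpa using hg
      exact ⟨0, by simp [hg0, div_nonneg (ht0 _) hr.le]⟩
    · have hgV : g ∈ Submodule.span 𝕜 (Set.range fun j : Fin (n + 1) => (f j).y) := by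
        refine Submodule.span_le.2 ?_ hg
        rintro _ ⟨j, hj, rfl⟩
        exact Submodule.smul_mem _ _ (Submodule.subset_span ⟨⟨j, hj⟩, rfl⟩)
      obtain ⟨u, hu, hu1, hgu⟩ := hS _ (.span_of_finite 𝕜 (Set.finite_range _)) g hgV
      refine ⟨u, hu1, hgu, fun j hj => (norm_coord_apply_le hf hr j u).trans ?_⟩
      gcongr
      exact (hf j).norm_apply_norming_le ⟨n, hj⟩ u hu
  · rintro _ ⟨k, rfl⟩
    exact .of_nonneg_of_le (fun _ => norm_nonneg _) (fun j => norm_coord_apply_le hf hr j _)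
      ((summable_norm_apply hf ht k).div_const r)

end Stage

end Sequence

section Increments

variable {𝕜 : Type*} [RCLike 𝕜] {W : Type*} [NormedAddCommGroup W] [NormedSpace 𝕜 W] {Z : Type*}
  [NormedAddCommGroup Z] [NormedSpace 𝕜 Z]

theorem exists_pos_summable_tsum_le {η : ℝ} (hη : 0 < η) :
    ∃ t : ℕ → ℝ, (∀ n, 0 < t n) ∧ Summable t ∧ ∑' n, t n ≤ η :=
  let t := posSumOfEncodable hη ℕ
  let ⟨_, ht, hc⟩ := t.2.2
  ⟨t.1, t.2.1, ht.summable, ht.tsum_eq.trans_le hc⟩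

theorem exists_pos_summable_error {a : ℝ} (ha : a < 1) {r : ℝ} (hr : 0 < r) (M : ℝ) {C : ℝ}
    (hC : 1 < C) : ∃ t : ℕ → ℝ, (∀ n, 0 < t n) ∧ Summable t ∧ a + ∑' n, t n ≤ 1 ∧
      1 + M * ∑' n, t n / r ≤ C := by
  have hM : 0 < max M 1 := lt_max_of_lt_right one_pos
  have hη : 0 < min (1 - a) ((C - 1) * r / max M 1) := by
    have := sub_pos.2 hC
    have := sub_pos.2 ha
    positivity
  obtain ⟨t, ht0, ht, hts⟩ := exists_pos_summable_tsum_le hη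
  rw [le_min_iff, le_div_iff₀' hM] at hts
  refine ⟨t, ht0, ht, by linarith [hts.1], ?_⟩
  have hMt : M * ∑' n, t n ≤ (C - 1) * r :=
    (mul_le_mul_of_nonneg_right (le_max_left M 1) (tsum_nonneg fun n => (ht0 n).le)).trans hts.2
  rw [tsum_div_const, ← mul_div_assoc, ← le_sub_iff_add_le', div_le_iff₀ hr]
  exact hMt

theorem exists_orthogonal_increments [CompleteSpace Z] [TopologicalSpace.SeparableSpace Z]
    (R : W →L[𝕜] Z) {K : Set (StrongDual 𝕜 Z)} {ε r : ℝ} (hKc : Convex ℝ K) (hKb : Balanced 𝕜 K)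
    (hK : IsCompact (StrongDual.toWeakDual '' K))
    (hsep : ∃ A ⊆ (fun f : StrongDual 𝕜 Z => f.comp R) '' K,
      ¬A.Countable ∧ Metric.IsSeparated (ENNReal.ofReal ε) A)
    (hr : 0 < r) (hrε : 2 * r < ε) {p : ℕ → ℕ} (hp : ∀ n ≠ 0, p n < n) {C : ℝ} (hC : 1 < C) :
    ∃ (w : ℕ → W) (y : ℕ → StrongDual 𝕜 Z), (∀ n, ‖w n‖ = 1) ∧ (∀ n, (r : 𝕜) < y n (R (w n))) ∧
      (Pairwise fun i j => y i (R (w j)) = 0) ∧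
      (∀ P, IsRootedPath p P → ∀ m, ∑ j ∈ Finset.range m, P.indicator y j ∈ K) ∧
      Dense {v | Summable fun n => ‖y n v‖} ∧
      IsBasicWithConstLE 𝕜 w C ∧
      IsBasisWithConstLE 𝕜 (fun n => (commonKer y).mkQ (R (w n))) C := by
  have hε : 0 < ε := by linarith
  obtain ⟨a, hra, ha1⟩ := exists_between ((div_lt_one hε).2 hrε)
  have ha : 0 < a := (div_pos (by linarith) hε).trans hra
  have hC' : 1 < √C := Real.lt_sqrt_of_sq_lt (by simpa using hC)
  obtain ⟨t, ht0, ht, hat, htC⟩ := exists_pos_summable_error ha1 hr ‖R‖ hC'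
  obtain ⟨M, hM⟩ := exists_forall_norm_le_of_isCompact_toWeakDual hK
  obtain ⟨B, hBK, hB0, hB, hBsep⟩ := exists_preperfect_separated R hK hsep ha
  choose! G hG using fun (V : Submodule 𝕜 W) (_ : FiniteDimensional 𝕜 V) =>
    exists_finset_dual_norming V hC
  choose! S hS using fun (V : Submodule 𝕜 (StrongDual 𝕜 Z)) (_ : FiniteDimensional 𝕜 V) =>
    exists_finset_predual_norming V hC'
  have hK0 : 0 ∈ K :=
    Balanced.zero_mem (E := StrongDual 𝕜 Z) hKb (Set.smul_set_nonempty.1 (hB0.mono hBK))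
  have haK : a • K ⊆ K := by
    rintro _ ⟨f, hf, rfl⟩
    exact hKc.smul_mem_of_zero_mem hK0 hf ⟨ha.le, ha1.le⟩
  obtain ⟨f, hf⟩ := Stage.exists_seq_isNext (K := K) (G := G) (S := S)
    (d := TopologicalSpace.denseSeq Z) (fun f hf => hM f (haK (hBK hf))) hBsep hr.le
    ((div_lt_iff₀ hε).1 hra) hB0 hB ((hBK.trans haK).trans Submodule.subset_span) hKc hKb hK0 hp ht0
  refine ⟨fun n => (f n).w, fun n => (f n).y, fun n => (hf n).norm_w, fun n => (hf n).lt_apply,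
    Stage.pairwise_apply_eq_zero_of_forall hf, fun P hP => ?_, ?_,
    Stage.isBasicWithConstLE hf hr (by linarith) hG, ?_⟩
  · exact hP.sum_indicator_mem hKc hK0 ha.le (fun n => (ht0 n).le) ht hat
      (fun n => hBK (hf n).x_mem) (Stage.y_sub_mem_smul hf hK0 hp)
  · refine (TopologicalSpace.denseRange_denseSeq Z).mono ?_
    rintro _ ⟨k, rfl⟩
    exact Stage.summable_norm_apply hf ht k
  · refine (Stage.isBasisWithConstLE_mkQ hf hr ht (fun n => (ht0 n).le)
      (TopologicalSpace.denseRange_denseSeq Z) (by linarith) hS).mono ?_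
    calc √C * (1 + ‖R‖ * ∑' n, t n / r) ≤ √C * √C := by gcongr
      _ = C := Real.mul_self_sqrt (by linarith)

end Increments

section WeakDualLimit

variable {𝕜 : Type*} [RCLike 𝕜] {Z : Type*} [NormedAddCommGroup Z] [NormedSpace 𝕜 Z]
  {K : Set (StrongDual 𝕜 Z)}

theorem exists_mem_forall_apply_eq_of_tendsto (hK : IsCompact (StrongDual.toWeakDual '' K))
    {ι : Type*} {l : Filter ι} [l.NeBot] {g : ι → StrongDual 𝕜 Z} (hg : ∀ i, g i ∈ K) :
    ∃ f ∈ K, ∀ v c, Tendsto (fun i => g i v) l (𝓝 c) → f v = c := by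
  obtain ⟨_, ⟨f, hf, rfl⟩, hfg⟩ := hK.ultrafilter_le_nhds
    ((Ultrafilter.of l).map fun i => StrongDual.toWeakDual (g i))
    (le_principal_iff.2 (mem_map.2 (univ_mem' fun i => ⟨g i, hg i, rfl⟩)))
  refine ⟨f, hf, fun v c hc => tendsto_nhds_unique ?_ (hc.mono_left (Ultrafilter.of_le l))⟩
  exact ((WeakDual.eval_continuous v).tendsto (StrongDual.toWeakDual f)).comp hfg

theorem continuous_toWeakDual_of_dense {α : Type*} [TopologicalSpace α] {z : α → StrongDual 𝕜 Z}
    {M : ℝ} (hz : ∀ a, ‖z a‖ ≤ M) {D : Set Z} (hD : Dense D)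
    (hDz : ∀ v ∈ D, Continuous fun a => z a v) :
    Continuous fun a => StrongDual.toWeakDual (z a) := by
  refine WeakDual.continuous_of_continuous_eval fun v => continuous_iff_continuousAt.2 fun a => ?_
  have hclosed := (equicontinuous_of_norm_le hz).isClosed_setOfPred_tendsto (l := 𝓝 a)
    (z a).continuous
  exact closure_minimal (fun u hu => (hDz u hu).tendsto a) hclosed (hD v)

/-- On a dense set the series converges uniformly in `a`, and its terms are locally constant. -/
theorem exists_continuous_toWeakDual_eq_of_hasSum [CompleteSpace Z]
    (hK : IsCompact (StrongDual.toWeakDual '' K)) {α : Type*} [TopologicalSpace α]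
    {C : α → Set ℕ} (hC : ∀ j, IsClopen {a | j ∈ C a}) {y : ℕ → StrongDual 𝕜 Z}
    (hy : ∀ a m, ∑ j ∈ Finset.range m, (C a).indicator y j ∈ K)
    (hd : Dense {v | Summable fun j => ‖y j v‖}) :
    ∃ z : α → StrongDual 𝕜 Z, (∀ a, z a ∈ K) ∧ Continuous (fun a => StrongDual.toWeakDual (z a)) ∧
      ∀ a v c, HasSum ((C a).indicator fun j => y j v) c → z a v = c := by
  choose z hzK hz using fun a => exists_mem_forall_apply_eq_of_tendsto hK (l := atTop) (hy a)
  have hsum (a : α) (v : Z) (c : 𝕜) (hv : HasSum ((C a).indicator fun j => y j v) c) :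
      z a v = c := by
    refine hz a v c (hv.tendsto_sum_nat.congr fun m => ?_)
    rw [sum_apply]
    exact Finset.sum_congr rfl fun j _ => by by_cases hj : j ∈ C a <;> simp [hj]
  obtain ⟨M, hM⟩ := exists_forall_norm_le_of_isCompact_toWeakDual hK
  refine ⟨z, hzK, continuous_toWeakDual_of_dense (fun a => hM _ (hzK a)) hd fun v hv => ?_, hsum⟩
  have hvs : Summable fun j => y j v := hv.of_norm
  simp only [hsum _ v _ (hvs.indicator _).hasSum]
  refine continuous_tsum (fun j => ?_) hv fun j a => norm_indicator_le_norm_self _ _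
  exact (hC j).continuous_indicator continuous_const

theorem commonKer_eq_of_apply_eq_of_hasSum {y z : ℕ → StrongDual 𝕜 Z} {C : ℕ → Set ℕ}
    (hC : ∀ n, n ∈ C n) (hCn : ∀ n, C n ⊆ Set.Iic n)
    (hz : ∀ n v c, HasSum ((C n).indicator fun j => y j v) c → z n v = c) :
    commonKer z = commonKer y := by
  have hsum (n : ℕ) (v : Z) :
      z n v = ∑ j ∈ Finset.Iic n, (C n).indicator (fun j => y j v) j :=
    hz n v _ (hasSum_sum_of_ne_finset_zero fun j hj =>
      Set.indicator_of_notMem (fun hjn => hj (Finset.mem_Iic.2 (hCn n hjn))) _)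
  ext v
  simp only [commonKer, Submodule.mem_iInf, LinearMap.mem_ker, ContinuousLinearMap.coe_coe]
  refine ⟨fun hv n => ?_, fun hv n => by simp [hsum, hv]⟩
  induction n using Nat.strong_induction_on with
  | h n ih =>
    have hzy : z n v = y n v := by
      rw [hsum, Finset.sum_eq_single_of_mem n (Finset.mem_Iic.2 le_rfl),
        Set.indicator_of_mem (hC n)]
      exact fun j _ hj => Set.indicator_apply_eq_zero.2 fun hjn => ih j ((hCn n hjn).lt_of_ne hj)
    rw [← hzy, hv]

end WeakDualLimit

section Tree

variable {T : Set (List ℕ)}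

/-- The node of `T` with its last entry removed; the root is its own parent. -/
def IsDownClosed.parent (hT : IsDownClosed T) (s : T) : T :=
  ⟨(s : List ℕ).dropLast, hT s s.2 _ (List.dropLast_prefix _)⟩

namespace TreeBar

/-- The indices, in the enumeration `τ`, of the nodes below `t`. -/
def indicesBelow (τ : ℕ ≃ T) (t : TreeBar T) : Set ℕ :=
  {j | node (τ j) ≤ t}

theorem mem_indicesBelow_self (τ : ℕ ≃ T) (n : ℕ) : n ∈ indicesBelow τ (node (τ n)) :=
  le_refl (node (τ n))

theorem node_le_node {s t : T} : node s ≤ node t ↔ (s : List ℕ) <+: (t : List ℕ) := Iff.rfl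

theorem not_branch_le_node {b : {b : Set (List ℕ) // IsInfiniteBranch T b}} {s : T} :
    ¬branch b ≤ node s := id

theorem node_le_node_or_of_le {s u : T} {t : TreeBar T} (hs : node s ≤ t) (hu : node u ≤ t) :
    node s ≤ node u ∨ node u ≤ node s := by
  cases t with
  | node t => exact List.prefix_or_prefix_of_prefix hs hu
  | branch b => exact b.2.2.prop.2.total hs hu

theorem Iio_node_eq_empty {s : T} (hs : (s : List ℕ) = []) : Set.Iio (node s) = ∅ := by
  refine Set.eq_empty_of_forall_notMem fun t (ht : t < node s) => ht.not_ge ?_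
  cases t with
  | node u => exact node_le_node.2 (hs ▸ List.nil_prefix)
  | branch b => exact (not_branch_le_node ht.le).elim

theorem isGreatest_Iio_node (hT : IsDownClosed T) {s : T} (hs : (s : List ℕ) ≠ []) :
    IsGreatest (Set.Iio (node s)) (node (hT.parent s)) := by
  constructor
  · refine lt_of_le_not_ge (node_le_node.2 (List.dropLast_prefix _)) fun h => ?_
    have hlen := (node_le_node.1 h).length_le
    have := List.length_pos_iff.2 hs
    rw [IsDownClosed.parent, List.length_dropLast] at hlen
    omega
  · intro t (ht : t < node s)
    cases t with
    | node u =>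
      have hus : (u : List ℕ) <+: (s : List ℕ).dropLast ++ [(s : List ℕ).getLast hs] := by
        rw [List.dropLast_append_getLast hs]
        exact node_le_node.1 ht.le
      refine (List.prefix_concat_iff.1 hus).resolve_left fun h => ht.ne ?_
      rw [List.dropLast_append_getLast hs] at h
      rw [Subtype.ext h]
    | branch b => exact (not_branch_le_node ht.le).elim

theorem isClopen_Ici_node (hT : IsDownClosed T) (s : T) : IsClopen (Set.Ici (node s)) := by
  have hs : Set.Iio (node s) = ∅ ∨ ∃ m, IsGreatest (Set.Iio (node s)) m :=
    (em ((s : List ℕ) = [])).imp Iio_node_eq_empty fun h => ⟨_, isGreatest_Iio_node hT h⟩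
  exact ⟨⟨TopologicalSpace.isOpen_generateFrom_of_mem ⟨_, hs, Or.inr rfl⟩⟩,
    TopologicalSpace.isOpen_generateFrom_of_mem ⟨_, hs, Or.inl rfl⟩⟩

theorem isRootedPath_indicesBelow (hT : IsDownClosed T) (τ : ℕ ≃ T)
    (hτ : ∀ l m : ℕ, (τ l : List ℕ) <+: (τ m : List ℕ) → l ≤ m) (t : TreeBar T) :
    IsRootedPath (fun n => τ.symm (hT.parent (τ n))) (indicesBelow τ t) := by
  intro n hn hn0
  have hne : (τ n : List ℕ) ≠ [] := fun h =>
    hn0 (Nat.le_zero.1 (hτ n 0 (h ▸ List.nil_prefix)))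
  obtain ⟨hlt, hub⟩ := isGreatest_Iio_node hT hne
  obtain ⟨k, hk⟩ := τ.surjective (hT.parent (τ n))
  simp only [← hk, Equiv.symm_apply_apply] at hlt hub ⊢
  rw [Set.mem_Iio] at hlt
  refine ⟨⟨hlt.le.trans hn, (hτ k n hlt.le).lt_of_ne fun h => hlt.ne (by rw [h])⟩, ?_⟩
  rintro j ⟨hj, hjn⟩
  have hnj : ¬node (τ n) ≤ node (τ j) := fun h => (hτ n j h).not_gt hjn
  exact hτ j k (hub (lt_of_le_not_ge ((node_le_node_or_of_le hj hn).resolve_right hnj) hnj))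

theorem exists_continuous_toWeakDual {𝕜 : Type*} [RCLike 𝕜] {Z : Type*} [NormedAddCommGroup Z]
    [NormedSpace 𝕜 Z] [CompleteSpace Z] {K : Set (StrongDual 𝕜 Z)}
    (hK : IsCompact (StrongDual.toWeakDual '' K)) (hT : IsDownClosed T) (τ : ℕ ≃ T)
    (hτ : ∀ l m : ℕ, (τ l : List ℕ) <+: (τ m : List ℕ) → l ≤ m) {y : ℕ → StrongDual 𝕜 Z}
    (hy : ∀ t m, ∑ j ∈ Finset.range m, (indicesBelow τ t).indicator y j ∈ K)
    (hd : Dense {v | Summable fun j => ‖y j v‖}) :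
    ∃ z : TreeBar T → StrongDual 𝕜 Z, (∀ t, z t ∈ K) ∧
      Continuous (fun t => StrongDual.toWeakDual (z t)) ∧
      (∀ t v c, HasSum ((indicesBelow τ t).indicator fun j => y j v) c → z t v = c) ∧
      commonKer (fun t : T => z (node t)) = commonKer y := by
  obtain ⟨z, hzK, hzc, hz⟩ := exists_continuous_toWeakDual_eq_of_hasSum hK
    (fun j => isClopen_Ici_node hT (τ j)) hy hd
  refine ⟨z, hzK, hzc, hz, ?_⟩
  calc commonKer (fun t : T => z (node t)) = commonKer fun n => z (node (τ n)) :=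
        (τ.iInf_comp (g := fun t => (z (node t)).toLinearMap.ker)).symm
    _ = commonKer y := commonKer_eq_of_apply_eq_of_hasSum (mem_indicesBelow_self τ)
        (fun n j => hτ j n) fun n => hz (node (τ n))

end TreeBar

end Tree

theorem mainTheorem1_general {𝕜 : Type*} [RCLike 𝕜]
    {W : Type*} [NormedAddCommGroup W] [NormedSpace 𝕜 W]
    {Z : Type*} [NormedAddCommGroup Z] [NormedSpace 𝕜 Z] [CompleteSpace Z]
    [TopologicalSpace.SeparableSpace Z]
    (R : W →L[𝕜] Z) (K : Set (StrongDual 𝕜 Z)) (ε : ℝ) (hε : 0 < ε)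
    (hKconv : AbsConvex 𝕜 K)
    (hKcomp : IsCompact (StrongDual.toWeakDual '' K))
    (hKsep : ∃ A ⊆ (fun f : StrongDual 𝕜 Z => f.comp R) '' K,
      ¬ A.Countable ∧ Metric.IsSeparated (ENNReal.ofReal ε) A)
    (δ : ℝ) (hδ : 0 < δ) (θ : ℝ) (hθ : 0 < θ)
    (T : Set (List ℕ)) (hT : IsDownClosed T)
    (τ : ℕ ≃ T) (hτ : ∀ l m : ℕ, (τ l : List ℕ) <+: (τ m : List ℕ) → l ≤ m) :
    ∃ (w : T → W) (z : TreeBar T → StrongDual 𝕜 Z),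
      (∀ t, ‖w t‖ = 1) ∧ (∀ t, z t ∈ K) ∧
      (∀ (s : T) (t : TreeBar T),
        (TreeBar.node s ≤ t →
          z t (R (w s)) = z (TreeBar.node s) (R (w s)) ∧
          ((ε / (2 + θ) : ℝ) : 𝕜) < z (TreeBar.node s) (R (w s))) ∧
        (¬ TreeBar.node s ≤ t → z t (R (w s)) = 0)) ∧
      Continuous (fun t => StrongDual.toWeakDual (z t)) ∧
      IsBasicWithConstLE 𝕜 (fun m => w (τ m)) (1 + δ) ∧
      IsBasisWithConstLE 𝕜
        (fun m => (commonKer fun t : T => z (TreeBar.node t)).mkQ (R (w (τ m)))) (1 + δ) := by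
  have hrε : 2 * (ε / (2 + θ)) < ε := by
    rw [← mul_div_assoc, div_lt_iff₀ (by positivity)]
    nlinarith
  have hpath := TreeBar.isRootedPath_indicesBelow hT τ hτ
  obtain ⟨w, y, hw, hyr, hyw, hyK, hyd, hwC, hyC⟩ := exists_orthogonal_increments R
    (convex_RCLike_iff_convex_real.1 hKconv.2) hKconv.1 hKcomp hKsep (by positivity) hrε
    (fun n hn => (hpath _ n (TreeBar.mem_indicesBelow_self τ n) hn).1.2) (lt_add_of_pos_right 1 hδ)
  obtain ⟨z, hzK, hzc, hz, hker⟩ := TreeBar.exists_continuous_toWeakDual hKcomp hT τ hτ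
    (fun t => hyK _ (hpath t)) hyd
  have hzw (n : ℕ) (t : TreeBar T) :
      z t (R (w n)) = (TreeBar.indicesBelow τ t).indicator (fun j => y j (R (w n))) n := by
    refine hz t _ _ (hasSum_single n fun j hj => ?_)
    exact Set.indicator_apply_eq_zero.2 fun _ => hyw hj
  refine ⟨fun t => w (τ.symm t), z, fun t => hw _, hzK, τ.forall_congr_right.1 fun n t => ?_, hzc,
    by simpa using hwC, by simpa using hyC.mkQ_congr hker.symm⟩
  simp only [Equiv.symm_apply_apply, hzw,
    Set.indicator_of_mem (TreeBar.mem_indicesBelow_self τ n)]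
  exact ⟨fun (h : n ∈ TreeBar.indicesBelow τ t) => ⟨Set.indicator_of_mem h _, hyr n⟩,
    fun (h : n ∉ TreeBar.indicesBelow τ t) => Set.indicator_of_notMem h _⟩

theorem mainTheorem1 {𝕜 : Type*} [RCLike 𝕜]
    {W : Type*} [NormedAddCommGroup W] [NormedSpace 𝕜 W] [CompleteSpace W]
    {Z : Type*} [NormedAddCommGroup Z] [NormedSpace 𝕜 Z] [CompleteSpace Z]
    [TopologicalSpace.SeparableSpace Z]
    (R : W →L[𝕜] Z) (K : Set (StrongDual 𝕜 Z)) (ε : ℝ) (hε : 0 < ε)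
    (hKconv : AbsConvex 𝕜 K)
    (hKcomp : IsCompact (StrongDual.toWeakDual '' K))
    (hKsep : ∃ A ⊆ (fun f : StrongDual 𝕜 Z => f.comp R) '' K,
      ¬ A.Countable ∧ Metric.IsSeparated (ENNReal.ofReal ε) A)
    (δ : ℝ) (hδ : 0 < δ) (θ : ℝ) (hθ : 0 < θ)
    (T : Set (List ℕ)) (hT : IsDownClosed T)
    (τ : ℕ ≃ T) (hτ : ∀ l m : ℕ, (τ l : List ℕ) <+: (τ m : List ℕ) → l ≤ m) :
    ∃ (w : T → W) (z : TreeBar T → StrongDual 𝕜 Z),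
      (∀ t, ‖w t‖ = 1) ∧ (∀ t, z t ∈ K) ∧
      -- the strict inequality in `𝕜` says that the right-hand side is real and exceeds `ε / (2 + θ)`
      (∀ (s : T) (t : TreeBar T),
        (TreeBar.node s ≤ t →
          z t (R (w s)) = z (TreeBar.node s) (R (w s)) ∧
          ((ε / (2 + θ) : ℝ) : 𝕜) < z (TreeBar.node s) (R (w s))) ∧
        (¬ TreeBar.node s ≤ t → z t (R (w s)) = 0)) ∧
      Continuous (fun t => StrongDual.toWeakDual (z t)) ∧
      IsBasicWithConstLE 𝕜 (fun m => w (τ m)) (1 + δ) ∧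
      IsBasisWithConstLE 𝕜
        (fun m => (commonKer fun t : T => z (TreeBar.node t)).mkQ (R (w (τ m)))) (1 + δ) :=
  mainTheorem1_general R K ε hε hKconv hKcomp hKsep δ hδ θ hθ T hT τ hτ
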